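/- Let $m,n$ be natural numbers, let $A\in\mathbb{R}^{m\times n}$, let $W\in\mathbb{R}^{n}$ be a nonzero vector, and put $C=AA^T$ and $Z=AW$. Assume that the $(m+1)\times n$ matrix $(A^T,W)^T$, whose rows are the rows of $A$ and $W^T$, has at least $n-1$ linearly independent rows. Then the system of quadratic and linear equations $XX^T=C$, $XW=Z$ in the unknown matrix $X\in\mathbb{R}^{m\times n}$ has exactly $d=\frac{(n-1)(n-2)}{2}$ degrees of freedom, in the following sense. Let $V$ be the set of all real solutions $X$. There is a set $S$ of $d$ positions $(i,j)$ such that, for all $X$ in a relatively open and dense subset of $V$, only finitely many $Y\in V$ have the same entries as $X$ at the positions in $S$; and for every set $S$ of fewer than $d$ positions, for all $X$ in a relatively open and dense subset of $V$, infinitely many $Y\in V$ have the same entries as $X$ at the positions in $S$. -/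

import Mathlib

open scoped Matrix

/-- The real solutions `A` (of size `m × n`) of the quadratic constraints `A Aᵀ = C`
together with the linear constraints `A W = Z`. -/
def solutionSet {m n : ℕ} (C : Matrix (Fin m) (Fin m) ℝ) (W : Fin n → ℝ) (Z : Fin m → ℝ) :
    Set (Matrix (Fin m) (Fin n) ℝ) :=
  {A | A * Aᵀ = C ∧ A *ᵥ W = Z}

/-- The matrix `(Aᵀ, W)ᵀ`: the rows of `A` followed by the row `Wᵀ`. -/
def augmented {m n : ℕ} (A : Matrix (Fin m) (Fin n) ℝ) (W : Fin n → ℝ) :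
    Matrix (Fin m ⊕ Unit) (Fin n) ℝ :=
  Matrix.fromRows A (Matrix.replicateRow Unit W)

/-- The matrix `M` has at least `k` linearly independent rows. -/
def HasIndependentRows {ι : Type*} {n : ℕ} (M : Matrix ι (Fin n) ℝ) (k : ℕ) : Prop :=
  ∃ s : Finset ι, k ≤ s.card ∧ LinearIndependent ℝ (fun i : s => M i.1)

/-- The elements of `V` that are still possible once the entries of `A` at the positions
in `S` are known. -/
def compatible {m n : ℕ} (V : Set (Matrix (Fin m) (Fin n) ℝ)) (S : Finset (Fin m × Fin n))
    (A : Matrix (Fin m) (Fin n) ℝ) : Set (Matrix (Fin m) (Fin n) ℝ) :=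
  {B | B ∈ V ∧ ∀ p ∈ S, B p.1 p.2 = A p.1 p.2}

/-- `P` holds for a generic element of `V`: on a subset of `V` which is open and dense in the
relative topology. -/
def ForGeneric {m n : ℕ} (V : Set (Matrix (Fin m) (Fin n) ℝ))
    (P : Matrix (Fin m) (Fin n) ℝ → Prop) : Prop :=
  ∃ U : Set V, IsOpen U ∧ Dense U ∧ ∀ A ∈ U, P A.1

/-- A system of equations in the entries of an `m × n` matrix, with (nonempty) solution set `V`,
has `d` degrees of freedom: `d` is the number of entries that have to be known in order to
recover a generic solution up to finitely many possibilities. That is, for some choice of `d`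
positions, knowing the entries there leaves only finitely many solutions, and for every choice
of fewer than `d` positions infinitely many solutions remain. -/
def HasDegreesOfFreedom {m n : ℕ} (V : Set (Matrix (Fin m) (Fin n) ℝ)) (d : ℕ) : Prop :=
  V.Nonempty ∧
  (∃ S : Finset (Fin m × Fin n), S.card = d ∧ ForGeneric V fun A => (compatible V S A).Finite) ∧
  (∀ S : Finset (Fin m × Fin n), S.card < d → ForGeneric V fun A => (compatible V S A).Infinite)

/-! Regard a matrix as the family of its rows in Euclidean space. Two families with the same Gram
matrix and the same inner products with `W` differ by an isometry fixing `W`, so `V` is an orbit of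
a compact group, essentially O(n-1), whose Lie algebra consists of the skew operators killing `W`
and has dimension d. By the rank hypothesis the rows and `W` span at least a hyperplane. A skew
operator vanishing on a hyperplane is zero, so the infinitesimal action is injective and `V` has
dimension d. The Cayley transform provides charts (`isChartFamily_cayleyChart`).

Fewer than d entries: on an open dense set the differentials of the chosen entries have locally
constant rank, less than d, and some curve in `V` keeps all of them fixed
(`exists_isOpen_dense_infinite_fibers`).

Exactly d entries: if the points where the d differentials are independent are dense, an
equidimensional Sard argument makes generic fibres discrete and compact, hence finite
(`exists_isOpen_dense_finite_fibers`). The positions form a staircase: entry `l` of row `k` with `k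
< l`, in n-2 rows independent together with `W`, and omitting a column where `W` is nonzero. Their
differentials are independent as soon as two flags, one from the rows and one from the basis
vectors, are in general position (`apply_eq_zero_of_triangular`), and small rotations about `W`
achieve this (`exists_regular`). -/

open Set Filter Topology MeasureTheory

open scoped InnerProductSpace

/-! ### Generic fibres of coordinates on a set with charts -/

/-- `φ x` is a `C¹` parametrization of a neighbourhood of `x` in `V`, defined on all of `E`, whose
differential at `K` is, up to an automorphism of `E`, the model differential `T (φ x K)`. -/
structure IsChartFamily {M E : Type*} [NormedAddCommGroup M] [NormedSpace ℝ M]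
    [NormedAddCommGroup E] [NormedSpace ℝ E] (V : Set M) (T : M → E →L[ℝ] M)
    (φ : M → E → M) : Prop where
  map_zero : ∀ x ∈ V, φ x 0 = x
  map_mem : ∀ x ∈ V, ∀ K, φ x K ∈ V
  contDiff : ∀ x ∈ V, ContDiff ℝ 1 (φ x)
  fderiv_eq : ∀ x ∈ V, ∀ K, ∃ D : E ≃L[ℝ] E, fderiv ℝ (φ x) K = (T (φ x K)).comp (D : E →L[ℝ] E)
  image_mem_nhdsWithin : ∀ x ∈ V, ∀ u ∈ 𝓝 (0 : E), φ x '' u ∈ 𝓝[V] x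

namespace IsChartFamily

variable {M E : Type*} [NormedAddCommGroup M] [NormedSpace ℝ M]
  [NormedAddCommGroup E] [NormedSpace ℝ E] {V : Set M}
  {T : M → E →L[ℝ] M} {φ : M → E → M}

theorem hasStrictFDerivAt (h : IsChartFamily V T φ) {x : M} (hx : x ∈ V) (K : E) :
    ∃ D : E ≃L[ℝ] E, HasStrictFDerivAt (φ x) ((T (φ x K)).comp (D : E →L[ℝ] E)) K := by
  obtain ⟨D, hD⟩ := h.fderiv_eq x hx K
  refine ⟨D, ?_⟩
  rw [← hD]
  exact ((h.contDiff x hx).contDiffAt).hasStrictFDerivAt one_ne_zero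

variable [FiniteDimensional ℝ E]

/-- The map `f` is a local diffeomorphism at `0` when read in the chart at a regular point. -/
theorem hasStrictFDerivAt_equiv (h : IsChartFamily V T φ) {F : Type*} [NormedAddCommGroup F]
    [NormedSpace ℝ F] [FiniteDimensional ℝ F] (hF : Module.finrank ℝ E = Module.finrank ℝ F)
    (f : M →L[ℝ] F) {x : M} (hx : x ∈ V) (hf : Function.Injective (f.comp (T x))) :
    ∃ D : E ≃L[ℝ] F, HasStrictFDerivAt (fun K => f (φ x K)) (D : E →L[ℝ] F) 0 := by
  obtain ⟨D, hD⟩ := h.hasStrictFDerivAt hx 0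
  rw [h.map_zero x hx] at hD
  have hinj : Function.Injective ((f.comp (T x)).comp (D : E →L[ℝ] E)).toLinearMap := by
    intro a b hab
    exact D.injective (hf hab)
  refine ⟨(LinearEquiv.ofInjectiveOfFinrankEq _ hinj hF).toContinuousLinearEquiv, ?_⟩
  have h2 := (f.hasStrictFDerivAt (x := φ x 0)).comp (0 : E) hD
  convert h2 using 1
  ext K
  rfl

/-- A generic fibre on `V` of a linear map to a space of the dimension of `V` is finite, as soon as
the regular points are dense. -/
theorem exists_isOpen_dense_finite_fibers (h : IsChartFamily V T φ) (hV : IsCompact V)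
    (hT : Continuous T) {F : Type*} [NormedAddCommGroup F] [NormedSpace ℝ F]
    [FiniteDimensional ℝ F] (hF : Module.finrank ℝ E = Module.finrank ℝ F) (f : M →L[ℝ] F)
    (hreg : ∀ x ∈ V, ∀ O ∈ 𝓝 x, ∃ y ∈ V, y ∈ O ∧ Function.Injective (f.comp (T y))) :
    ∃ U : Set V, IsOpen U ∧ Dense U ∧ ∀ x ∈ U, {y | y ∈ V ∧ f y = f x}.Finite := by
  have hcont : Continuous fun y => f.comp (T y) := by fun_prop
  have hopen : IsOpen {y | Function.Injective (f.comp (T y))} :=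
    ContinuousLinearMap.isOpen_injective.preimage hcont
  set crit := V ∩ {y | ¬ Function.Injective (f.comp (T y))}
  have hcritc : IsCompact crit := hV.inter_right hopen.isClosed_compl
  have himg : IsClosed (f '' crit) := (hcritc.image f.continuous).isClosed
  let _ : MeasurableSpace F := borel F
  have : BorelSpace F := ⟨rfl⟩
  let _ : MeasurableSpace E := borel E
  have : BorelSpace E := ⟨rfl⟩
  let μ : Measure F := Measure.addHaar
  let e : F ≃L[ℝ] E := ContinuousLinearEquiv.ofFinrankEq hF.symm
  -- Equidimensional Sard: finitely many charts cover `V`, and the image of a set on which the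
  -- Jacobian vanishes is null. The identification `e` makes each chart a map from `F` to itself, so
  -- that a determinant exists.
  have hnull : μ (f '' crit) = 0 := by
    obtain ⟨t, htV, ht⟩ := hV.elim_nhdsWithin_subcover (fun x => φ x '' univ)
      (fun x hx => h.image_mem_nhdsWithin x hx univ univ_mem)
    have hsub : f '' crit ⊆ ⋃ x ∈ t, (fun K => f (φ x (e K))) '' {K | φ x (e K) ∈ crit} := by
      rintro _ ⟨y, hy, rfl⟩
      obtain ⟨x, hxt, K, -, rfl⟩ := mem_iUnion₂.1 (ht hy.1)
      refine mem_iUnion₂.2 ⟨x, hxt, e.symm K, ?_, ?_⟩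
      · simpa using hy
      · simp
    refine measure_mono_null hsub ((measure_biUnion_null_iff t.countable_toSet).2 fun x hxt => ?_)
    have hd : ∀ K : F, ∃ D : E ≃L[ℝ] E, HasFDerivAt (fun K => f (φ x (e K)))
        (((f.comp (T (φ x (e K)))).comp (D : E →L[ℝ] E)).comp (e : F →L[ℝ] E)) K := by
      intro K
      obtain ⟨D, hD⟩ := h.hasStrictFDerivAt (htV x hxt) (e K)
      refine ⟨D, ?_⟩
      exact f.hasFDerivAt.comp K (hD.hasFDerivAt.comp K e.hasFDerivAt)
    choose D hD using hd
    refine addHaar_image_eq_zero_of_det_fderivWithin_eq_zero μ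
      (fun K _ => (hD K).hasFDerivWithinAt) fun K hK => ?_
    by_contra hdet
    refine hK.2 ?_
    have hb := (LinearMap.equivOfDetNeZero _ hdet).injective
    intro a b hab
    have := @hb (e.symm ((D K).symm a)) (e.symm ((D K).symm b)) (by simpa using hab)
    simpa using this
  refine ⟨{x | f x ∉ f '' crit}, ?_, ?_, ?_⟩
  · exact himg.isOpen_compl.preimage (f.continuous.comp continuous_subtype_val)
  · rw [dense_iff_inter_open]
    rintro O hO ⟨x, hxO⟩
    obtain ⟨O', hO', rfl⟩ := isOpen_induced_iff.1 hO
    obtain ⟨y, hyV, hyO, hy⟩ := hreg x x.2 O' (hO'.mem_nhds hxO)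
    obtain ⟨D, hD⟩ := h.hasStrictFDerivAt_equiv hF f hyV hy
    have hmap := hD.map_nhds_eq_of_equiv
    have hpre : φ y ⁻¹' O' ∈ 𝓝 (0 : E) := by
      refine (h.contDiff y hyV).continuous.continuousAt.preimage_mem_nhds ?_
      rw [h.map_zero y hyV]
      exact hO'.mem_nhds hyO
    have himgn : (fun K => f (φ y K)) '' (φ y ⁻¹' O') ∈ 𝓝 (f (φ y 0)) := by
      rw [← hmap]
      exact image_mem_map hpre
    -- Near a regular point `f` covers an open set, which cannot consist of critical values only.
    have hpos : μ ((fun K => f (φ y K)) '' (φ y ⁻¹' O')) ≠ 0 :=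
      (Measure.measure_pos_of_mem_nhds μ himgn).ne'
    have : ¬ (fun K => f (φ y K)) '' (φ y ⁻¹' O') ⊆ f '' crit :=
      fun hs => hpos (measure_mono_null hs hnull)
    obtain ⟨_, ⟨K, hK, rfl⟩, hKn⟩ := not_subset.1 this
    exact ⟨⟨φ y K, h.map_mem y hyV K⟩, hK, hKn⟩
  · rintro ⟨x, hxV⟩ hx
    have hcl : IsCompact {y | y ∈ V ∧ f y = f x} :=
      hV.inter_right (isClosed_eq f.continuous continuous_const)
    -- Every point of the fibre is regular, so `f` is injective near it on `V` and the point is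
    -- isolated in the fibre.
    have hiso : ∀ y ∈ {y | y ∈ V ∧ f y = f x}, ({y} : Set M) ∈ 𝓝[{y | y ∈ V ∧ f y = f x}] y := by
      rintro y ⟨hyV, hyx⟩
      have hyreg : Function.Injective (f.comp (T y)) := by
        by_contra hn
        exact hx ⟨y, ⟨hyV, hn⟩, hyx⟩
      obtain ⟨D, hD⟩ := h.hasStrictFDerivAt_equiv hF f hyV hyreg
      have hu := hD.eventually_left_inverse
      have hn := h.image_mem_nhdsWithin y hyV _ hu
      have hn' := nhdsWithin_mono y (fun z (hz : z ∈ V ∧ f z = f x) => hz.1) hn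
      filter_upwards [hn', self_mem_nhdsWithin] with z hz hz2
      obtain ⟨K, hK, rfl⟩ := hz
      have hK0 : K = 0 := by
        have h0 := hu.self_of_nhds
        have hK' : _ = K := hK
        have heq : f (φ y K) = f (φ y 0) := by rw [h.map_zero y hyV, hz2.2, hyx]
        rw [← hK', heq, h0]
      rw [hK0, h.map_zero y hyV]
      rfl
    obtain ⟨t, -, ht⟩ := hcl.elim_nhdsWithin_subcover (fun y => {y}) hiso
    refine t.finite_toSet.subset fun z hz => ?_
    obtain ⟨y, hy, hzy⟩ := mem_iUnion₂.1 (ht hz)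
    rw [mem_singleton_iff.1 hzy]
    exact hy

/-- At a point around which the rank of the coordinates in `S` is constant, `S` does not determine
the point up to finitely many possibilities if it has fewer than `dim V` elements. -/
theorem infinite_fiber_of_locally_constant_rank (h : IsChartFamily V T φ) {ι : Type*} [Finite ι]
    (ℓ : ι → M →L[ℝ] ℝ) (S S' : Finset ι) (hS' : S' ⊆ S) (hcard : S.card < Module.finrank ℝ E)
    {x : M} (hx : x ∈ V) (hsep : ∀ K, (∀ p, ℓ p (T x K) = 0) → K = 0)
    (hind : LinearIndepOn ℝ (fun p => (ℓ p).comp (T x)) (S' : Set ι))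
    (hspan : ∀ᶠ y in 𝓝[V] x, ∀ s ∈ S, (ℓ s).comp (T y) ∈
      Submodule.span ℝ ((fun p => (ℓ p).comp (T y)) '' (S' : Set ι))) :
    {y | y ∈ V ∧ ∀ p ∈ S, ℓ p y = ℓ p x}.Infinite := by
  classical
  cases nonempty_fintype ι
  -- Completing `S'` to a maximal set of coordinates with independent differentials at `x` gives
  -- local coordinates on `V`, since all coordinates together separate tangent vectors.
  set B : Set ι := hind.extend (subset_univ _)
  have hBind : LinearIndepOn ℝ (fun p => (ℓ p).comp (T x)) B := hind.linearIndepOn_extend _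
  have hSB : (S' : Set ι) ⊆ B := hind.subset_extend _
  have hBspan : ∀ p, (ℓ p).comp (T x) ∈
      Submodule.span ℝ ((fun p => (ℓ p).comp (T x)) '' B) := fun p =>
    hind.image_subset_span_image_extend (subset_univ _) ⟨p, mem_univ p, rfl⟩
  let f : M →L[ℝ] (B → ℝ) := ContinuousLinearMap.pi fun p => ℓ p
  have hf : Function.Injective (f.comp (T x)) := by
    rw [injective_iff_map_eq_zero]
    intro K hK
    refine hsep K fun p => ?_
    have hker : Submodule.span ℝ ((fun p => (ℓ p).comp (T x)) '' B) ≤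
        LinearMap.ker (ContinuousLinearMap.apply ℝ ℝ K).toLinearMap := by
      rw [Submodule.span_le]
      rintro _ ⟨q, hq, rfl⟩
      exact congrFun hK ⟨q, hq⟩
    exact hker (hBspan p)
  have hcardle : Fintype.card B ≤ Module.finrank ℝ E := by
    have h1 : LinearIndependent ℝ
        fun p : B => ((ℓ p).comp (T x) : E →L[ℝ] ℝ).toLinearMap := by
      have := hBind.linearIndependent.map' (ContinuousLinearMap.coeLM ℝ)
        (LinearMap.ker_eq_bot.2 ContinuousLinearMap.coe_injective)
      exact this
    have := h1.fintype_card_le_finrank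
    rwa [Subspace.dual_finrank_eq] at this
  have hF : Module.finrank ℝ E = Module.finrank ℝ (B → ℝ) := by
    rw [Module.finrank_fintype_fun_eq_card]
    refine le_antisymm ?_ hcardle
    have := LinearMap.finrank_le_finrank_of_injective (f := (f.comp (T x)).toLinearMap) hf
    rwa [Module.finrank_fintype_fun_eq_card] at this
  obtain ⟨t, ht⟩ : ∃ t : B, (t : ι) ∉ S' := by
    by_contra! hall
    have h1 : Fintype.card B ≤ S'.card := by
      rw [← Set.toFinset_card]
      exact Finset.card_le_card fun p hp => hall ⟨p, by simpa using hp⟩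
    have h2 := Finset.card_le_card hS'
    rw [Module.finrank_fintype_fun_eq_card] at hF
    omega
  obtain ⟨D, hD⟩ := h.hasStrictFDerivAt_equiv hF f hx hf
  have hCD : ContDiffAt ℝ 1 (fun K => f (φ x K)) 0 :=
    (f.contDiff.comp (h.contDiff x hx)).contDiffAt
  set g := hCD.localInverse hD.hasFDerivAt one_ne_zero
  have hgC : ContDiffAt ℝ 1 g (f (φ x 0)) := hCD.to_localInverse hD.hasFDerivAt one_ne_zero
  have hright : ∀ᶠ y in 𝓝 (f (φ x 0)), f (φ x (g y)) = y :=
    (hCD.hasStrictFDerivAt' hD.hasFDerivAt one_ne_zero).eventually_right_inverse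
  have hdiff : ∀ᶠ y in 𝓝 (f (φ x 0)), DifferentiableAt ℝ g y := by
    filter_upwards [hgC.eventually (by simp)] with y hy using hy.differentiableAt one_ne_zero
  have hg0 : g (f (φ x 0)) = 0 := hCD.localInverse_apply_image hD.hasFDerivAt one_ne_zero
  have hnear : ∀ᶠ y in 𝓝 (f (φ x 0)), ∀ s ∈ S, (ℓ s).comp (T (φ x (g y))) ∈
      Submodule.span ℝ ((fun p => (ℓ p).comp (T (φ x (g y)))) '' (S' : Set ι)) := by
    have h1 : Tendsto (fun y => φ x (g y)) (𝓝 (f (φ x 0))) (𝓝[V] x) := by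
      refine tendsto_nhdsWithin_iff.2 ⟨?_, Eventually.of_forall fun y => h.map_mem x hx _⟩
      have h2 : ContinuousAt (fun y => φ x (g y)) (f (φ x 0)) :=
        (h.contDiff x hx).continuous.continuousAt.comp hgC.continuousAt
      have hx0 : φ x (g (f (φ x 0))) = x := by rw [hg0, h.map_zero x hx]
      simpa only [hx0] using h2.tendsto
    exact h1.eventually hspan
  have hline : Tendsto (fun τ : ℝ => f (φ x 0) + τ • (Pi.single t 1 : B → ℝ)) (𝓝 0)
      (𝓝 (f (φ x 0))) := by
    have : Continuous fun τ : ℝ => f (φ x 0) + τ • (Pi.single t 1 : B → ℝ) := by fun_prop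
    simpa using this.tendsto 0
  obtain ⟨ε, hε, hball⟩ := Metric.eventually_nhds_iff_ball.1
    (hline.eventually (hright.and (hdiff.and hnear)))
  -- The curve in `V` through `x` along which, among the coordinates in `B`, only the one at `t ∉
  -- S'` moves.
  set γ : ℝ → M := fun τ => φ x (g (f (φ x 0) + τ • (Pi.single t 1 : B → ℝ))) with hγ
  have hγ0 : γ 0 = x := by
    simp only [hγ, zero_smul, add_zero]
    rw [hg0, h.map_zero x hx]
  have hfγ : ∀ τ ∈ Metric.ball (0 : ℝ) ε, ∀ p : B,
      ℓ p (γ τ) = ℓ p (φ x 0) + τ * (Pi.single t 1 : B → ℝ) p := by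
    intro τ hτ p
    exact congrFun (hball τ hτ).1 p
  have hγd : ∀ τ ∈ Metric.ball (0 : ℝ) ε, ∃ w : E, HasDerivAt γ (T (γ τ) w) τ := by
    intro τ hτ
    obtain ⟨D', hD'⟩ := h.hasStrictFDerivAt hx (g (f (φ x 0) + τ • (Pi.single t 1 : B → ℝ)))
    have h1 : HasDerivAt (fun τ : ℝ => f (φ x 0) + τ • (Pi.single t 1 : B → ℝ))
        (Pi.single t 1 : B → ℝ) τ := by
      simpa using ((hasDerivAt_id τ).smul_const (Pi.single t 1 : B → ℝ)).const_add (f (φ x 0))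
    have h2 := (hball τ hτ).2.1.hasFDerivAt.comp_hasDerivAt τ h1
    have h3 := hD'.hasFDerivAt.comp_hasDerivAt τ h2
    exact ⟨_, h3⟩
  -- The velocity of `γ` is killed by the differentials in `S'`, hence by those in `S`, which lie in
  -- their span all along the curve.
  have hconst : ∀ s ∈ S, ∀ τ ∈ Metric.ball (0 : ℝ) ε, ℓ s (γ τ) = ℓ s x := by
    intro s hs τ hτ
    have hder : ∀ τ ∈ Metric.ball (0 : ℝ) ε, HasDerivAt (fun τ => ℓ s (γ τ)) 0 τ := by
      intro τ hτ
      obtain ⟨w, hw⟩ := hγd τ hτ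
      have hker : Submodule.span ℝ ((fun p => (ℓ p).comp (T (γ τ))) '' (S' : Set ι)) ≤
          LinearMap.ker (ContinuousLinearMap.apply ℝ ℝ w).toLinearMap := by
        rw [Submodule.span_le]
        rintro _ ⟨q, hq, rfl⟩
        have h1 : HasDerivAt (fun τ => ℓ q (γ τ)) (ℓ q (T (γ τ) w)) τ :=
          (ℓ q).hasFDerivAt.comp_hasDerivAt τ hw
        have h2 : HasDerivAt (fun τ => ℓ q (γ τ)) 0 τ := by
          refine (hasDerivAt_const τ (ℓ q (φ x 0))).congr_of_eventuallyEq ?_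
          filter_upwards [Metric.isOpen_ball.mem_nhds hτ] with σ hσ
          have hne : (⟨q, hSB hq⟩ : B) ≠ t := by
            rintro rfl
            exact ht hq
          have := hfγ σ hσ ⟨q, hSB hq⟩
          rwa [Pi.single_eq_of_ne hne, mul_zero, add_zero] at this
        exact h1.unique h2
      have h3 : ℓ s (T (γ τ) w) = 0 := hker ((hball τ hτ).2.2 s hs)
      rw [← h3]
      exact (ℓ s).hasFDerivAt.comp_hasDerivAt τ hw
    have := Metric.isOpen_ball.is_const_of_deriv_eq_zero
      (convex_ball (0 : ℝ) ε).isPreconnected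
      (fun τ hτ => (hder τ hτ).differentiableAt.differentiableWithinAt)
      (fun τ hτ => (hder τ hτ).deriv) hτ (Metric.mem_ball_self hε)
    rw [this, hγ0]
  have hinj : InjOn γ (Metric.ball (0 : ℝ) ε) := by
    intro τ hτ σ hσ heq
    have h1 := hfγ τ hτ t
    have h2 := hfγ σ hσ t
    rw [heq] at h1
    simp only [Pi.single_eq_same, mul_one] at h1 h2
    linarith
  refine infinite_of_injOn_mapsTo hinj (fun τ hτ => ⟨h.map_mem x hx _, fun p hp =>
    hconst p hp τ hτ⟩) ?_
  exact infinite_of_mem_nhds 0 (Metric.ball_mem_nhds 0 hε)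

/-- Fewer than `dim V` coordinates do not determine a generic point of `V` up to finitely many
possibilities. -/
theorem exists_isOpen_dense_infinite_fibers (h : IsChartFamily V T φ) (hT : Continuous T)
    {ι : Type*} [Finite ι] (ℓ : ι → M →L[ℝ] ℝ)
    (hsep : ∀ x ∈ V, ∀ K, (∀ p, ℓ p (T x K) = 0) → K = 0) (S : Finset ι)
    (hcard : S.card < Module.finrank ℝ E) :
    ∃ U : Set V, IsOpen U ∧ Dense U ∧
      ∀ x ∈ U, {y | y ∈ V ∧ ∀ p ∈ S, ℓ p y = ℓ p x}.Infinite := by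
  classical
  let ind (S' : Finset ι) (y : M) : Prop :=
    LinearIndepOn ℝ (fun p => (ℓ p).comp (T y)) (S' : Set ι)
  have hindopen : ∀ S', IsOpen {y | ind S' y} := by
    intro S'
    have hc : Continuous fun y => fun p : (S' : Set ι) => (ℓ p).comp (T y) := by fun_prop
    exact isOpen_setOfPred_linearIndependent.preimage hc
  refine ⟨{x | ∃ S' ⊆ S, ind S' x ∧ ∀ᶠ y : V in 𝓝 x, ∀ s ∈ S, (ℓ s).comp (T y) ∈
      Submodule.span ℝ ((fun p => (ℓ p).comp (T y)) '' (S' : Set ι))}, ?_, ?_, ?_⟩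
  · rw [isOpen_iff_eventually]
    rintro x ⟨S', hS', hi, hs⟩
    filter_upwards [eventually_eventually_nhds.2 hs,
      continuous_subtype_val.continuousAt.eventually ((hindopen S').mem_nhds hi)] with y hy hy2
    exact ⟨S', hS', hy2, hy⟩
  · rw [dense_iff_inter_open]
    rintro O hO ⟨x₀, hx₀⟩
    -- A subset of `S` of maximal size among those independent somewhere in `O` stays independent
    -- nearby, and by maximality it spans there.
    let P : Set (Finset ι) := {S' | S' ⊆ S ∧ ∃ x ∈ O, ind S' x}
    have hPfin : P.Finite := (S.powerset.finite_toSet).subset fun S' h => by simpa using h.1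
    have hPne : P.Nonempty := ⟨∅, by simp, x₀, hx₀, by simp [ind]⟩
    obtain ⟨S', ⟨hS', x, hxO, hi⟩, hmax⟩ := hPfin.exists_maximalFor Finset.card P hPne
    refine ⟨x, hxO, S', hS', hi, ?_⟩
    filter_upwards [hO.mem_nhds hxO,
      continuous_subtype_val.continuousAt.eventually ((hindopen S').mem_nhds hi)] with y hy hy2 s hs
    by_contra hns
    have hsS' : s ∉ S' := fun hmem => hns (Submodule.subset_span ⟨s, hmem, rfl⟩)
    have hi' : ind (insert s S') y := by
      have := hy2.insert hns
      simpa [ind] using this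
    have := hmax (j := insert s S') ⟨Finset.insert_subset hs hS', y, hy, hi'⟩
      (Finset.card_le_card (Finset.subset_insert s S'))
    rw [Finset.card_insert_of_notMem hsS'] at this
    omega
  · rintro x ⟨S', hS', hi, hs⟩
    refine h.infinite_fiber_of_locally_constant_rank ℓ S S' hS' hcard x.2 (hsep x x.2) hi ?_
    rw [nhdsWithin_eq_map_subtype_coe x.2]
    exact hs

end IsChartFamily

/-! ### The isometries fixing a vector and the Cayley transform -/

section Stabilizer

variable {H : Type*} [NormedAddCommGroup H] [InnerProductSpace ℝ H] [FiniteDimensional ℝ H]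

/-- The skew-adjoint operators killing `w`: the Lie algebra of the group of isometries fixing
`w`. -/
def stabilizerAlgebra (w : H) : Submodule ℝ (H →L[ℝ] H) where
  carrier := {K | star K = -K ∧ K w = 0}
  add_mem' {K L} hK hL := ⟨by rw [star_add, hK.1, hL.1, neg_add], by simp [hK.2, hL.2]⟩
  zero_mem' := by simp
  smul_mem' c K hK := ⟨by simp [star_smul, hK.1], by simp [hK.2]⟩

/-- The isometries fixing `w`. -/
def stabilizerGroup (w : H) : Set (H →L[ℝ] H) :=
  {Q | star Q * Q = 1 ∧ Q * star Q = 1 ∧ Q w = w}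

/-- The families with the same Gram matrix as `a` and the same inner products with `w`. -/
def congruentFamilies {ι : Type*} (w : H) (a : ι → H) : Set (ι → H) :=
  {x | (∀ i j, ⟪x i, x j⟫_ℝ = ⟪a i, a j⟫_ℝ) ∧ ∀ i, ⟪x i, w⟫_ℝ = ⟪a i, w⟫_ℝ}

/-- The Cayley transform. -/
noncomputable def cayley (K : H →L[ℝ] H) : H →L[ℝ] H := (1 - K) * Ring.inverse (1 + K)

theorem inner_apply_left_of_star_eq_neg {K : H →L[ℝ] H} (hK : star K = -K) (x y : H) :
    ⟪K x, y⟫_ℝ = -⟪x, K y⟫_ℝ := by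
  rw [← ContinuousLinearMap.adjoint_inner_right, ← ContinuousLinearMap.star_eq_adjoint, hK]
  simp

theorem inner_apply_self_of_star_eq_neg {K : H →L[ℝ] H} (hK : star K = -K) (x : H) :
    ⟪K x, x⟫_ℝ = 0 := by
  have := inner_apply_left_of_star_eq_neg hK x x
  rw [real_inner_comm] at this
  rw [real_inner_comm]
  linarith

/-- Skewness gives ⟪x + K x, x⟫ = ‖x‖², so `1 + K` is injective. -/
theorem isUnit_one_add_of_star_eq_neg {K : H →L[ℝ] H} (hK : star K = -K) : IsUnit (1 + K) := by
  rw [ContinuousLinearMap.isUnit_iff_isUnit_toLinearMap, LinearMap.isUnit_iff_ker_eq_bot,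
    LinearMap.ker_eq_bot']
  intro x hx
  have h1 : x + K x = 0 := hx
  have h2 : ⟪x + K x, x⟫_ℝ = 0 := by rw [h1, inner_zero_left]
  rwa [inner_add_left, inner_apply_self_of_star_eq_neg hK, add_zero, inner_self_eq_zero] at h2

/-- As every vector has the form `x + K x`, this describes the transform without inverses. -/
theorem cayley_apply_add {K : H →L[ℝ] H} (hK : star K = -K) (x : H) :
    cayley K (x + K x) = x - K x := by
  have h := Ring.inverse_mul_cancel _ (isUnit_one_add_of_star_eq_neg hK)
  have h2 : cayley K * (1 + K) = 1 - K := by rw [cayley, mul_assoc, h, mul_one]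
  exact congrArg (fun L : H →L[ℝ] H => L x) h2

theorem exists_add_apply_eq {K : H →L[ℝ] H} (hK : star K = -K) (y : H) : ∃ x, x + K x = y := by
  have h := Ring.mul_inverse_cancel _ (isUnit_one_add_of_star_eq_neg hK)
  exact ⟨Ring.inverse (1 + K) y, congrArg (fun L : H →L[ℝ] H => L y) h⟩

theorem inner_cayley_cayley {K : H →L[ℝ] H} (hK : star K = -K) (x y : H) :
    ⟪cayley K x, cayley K y⟫_ℝ = ⟪x, y⟫_ℝ := by
  obtain ⟨x, rfl⟩ := exists_add_apply_eq hK x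
  obtain ⟨y, rfl⟩ := exists_add_apply_eq hK y
  rw [cayley_apply_add hK, cayley_apply_add hK]
  simp only [inner_sub_left, inner_sub_right, inner_add_left, inner_add_right,
    inner_apply_left_of_star_eq_neg hK]
  ring

theorem cayley_apply_of_apply_eq_zero {K : H →L[ℝ] H} (hK : star K = -K) {x : H}
    (hx : K x = 0) : cayley K x = x := by
  have := cayley_apply_add hK x
  rwa [hx, add_zero, sub_zero] at this

theorem contDiff_cayley (w : H) :
    ContDiff ℝ 1 fun K : stabilizerAlgebra w => cayley (K : H →L[ℝ] H) := by
  rw [contDiff_iff_contDiffAt]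
  intro K
  obtain ⟨u, hu⟩ := isUnit_one_add_of_star_eq_neg K.2.1
  have hc : ContDiff ℝ 1 (stabilizerAlgebra w).subtypeL := ContinuousLinearMap.contDiff _
  have h1 : ContDiffAt ℝ 1 Ring.inverse (1 + (K : H →L[ℝ] H)) := by
    rw [← hu]
    exact contDiffAt_ringInverse ℝ u
  have h2 := h1.comp K (contDiff_const.add hc).contDiffAt
  exact (contDiff_const.sub hc).contDiffAt.mul h2

/-- With P = (1 + K)⁻¹ one has (1 - K)P = 2P - 1, so the product rule gives -δP - (2P - 1)δP =
-2PδP. -/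
theorem hasFDerivAt_cayley {w : H} (K : stabilizerAlgebra w) :
    HasFDerivAt (fun K : stabilizerAlgebra w => cayley (K : H →L[ℝ] H))
      ((-2 : ℝ) • (ContinuousLinearMap.mulLeftRight ℝ (H →L[ℝ] H) (Ring.inverse (1 + K.1))
        (Ring.inverse (1 + K.1))).comp (stabilizerAlgebra w).subtypeL) K := by
  have hunit := isUnit_one_add_of_star_eq_neg K.2.1
  have hP := Ring.mul_inverse_cancel _ hunit
  have hc : HasFDerivAt (fun K : stabilizerAlgebra w => (K : H →L[ℝ] H))
    (stabilizerAlgebra w).subtypeL K := (stabilizerAlgebra w).subtypeL.hasFDerivAt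
  have h1 : HasFDerivAt Ring.inverse (-ContinuousLinearMap.mulLeftRight ℝ (H →L[ℝ] H)
      (Ring.inverse (1 + K.1)) (Ring.inverse (1 + K.1))) (1 + K.1) := by
    obtain ⟨u, hu⟩ := hunit
    rw [← hu, Ring.inverse_unit]
    exact hasFDerivAt_ringInverse u
  have h2 := (hc.const_sub 1).mul' (h1.comp K (hc.const_add 1))
  refine h2.congr_fderiv ?_
  ext δ : 1
  simp only [Function.comp_apply, add_apply, smul_apply, ContinuousLinearMap.comp_apply,
    neg_apply, ContinuousLinearMap.mulLeftRight_apply, Submodule.subtypeL_apply, smul_eq_mul,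
    MulOpposite.smul_eq_mul_unop, MulOpposite.unop_op]
  set P := Ring.inverse (1 + K.1)
  have hsub : (1 - K.1) * P = P + P - 1 := by
    have : 1 - K.1 = 1 + 1 - (1 + K.1) := by abel
    rw [this, sub_mul, hP, add_mul, one_mul]
  have h3 : (1 - K.1) * (P * δ.1 * P) = ((1 - K.1) * P) * δ.1 * P := by simp only [mul_assoc]
  rw [mul_neg, h3, hsub, sub_mul, add_mul, sub_mul, add_mul, one_mul, neg_mul, neg_smul, two_smul]
  abel

theorem ContinuousLinearMap.mul_eq_one_symm_of_finiteDimensional {P Q : H →L[ℝ] H}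
    (h : P * Q = 1) : Q * P = 1 := by
  have hu : IsUnit Q := by
    rw [ContinuousLinearMap.isUnit_iff_isUnit_toLinearMap, LinearMap.isUnit_iff_ker_eq_bot,
      LinearMap.ker_eq_bot']
    intro x hx
    have h1 : (P * Q) x = x := by rw [h]; rfl
    rw [← h1]
    change P (Q x) = 0
    rw [show Q x = 0 from hx, map_zero]
  refine hu.mul_right_cancel ?_
  rw [mul_assoc, h, mul_one, one_mul]

theorem cayley_mem_stabilizerGroup {w : H} (K : stabilizerAlgebra w) :
    cayley K.1 ∈ stabilizerGroup w := by
  have h1 : star (cayley K.1) * cayley K.1 = 1 := by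
    ext x
    refine ext_inner_right ℝ fun y => ?_
    rw [ContinuousLinearMap.star_eq_adjoint]
    change ⟪ContinuousLinearMap.adjoint (cayley K.1) (cayley K.1 x), y⟫_ℝ = ⟪x, y⟫_ℝ
    rw [ContinuousLinearMap.adjoint_inner_left, inner_cayley_cayley K.2.1]
  exact ⟨h1, ContinuousLinearMap.mul_eq_one_symm_of_finiteDimensional h1,
    cayley_apply_of_apply_eq_zero K.2.1 K.2.2⟩

/-- The inverse Cayley transform. -/
theorem exists_cayley_eq {w : H} {R : H →L[ℝ] H} (hR : R ∈ stabilizerGroup w)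
    (hu : IsUnit (1 + R)) :
    ∃ K : stabilizerAlgebra w, K.1 = (1 - R) * Ring.inverse (1 + R) ∧ cayley K.1 = R := by
  obtain ⟨hR1, hR2, hRw⟩ := hR
  set K := (1 - R) * Ring.inverse (1 + R) with hK
  have hK1 : K * (1 + R) = 1 - R := by
    rw [hK, mul_assoc, Ring.inverse_mul_cancel _ hu, mul_one]
  have hK2 : (1 + star R) * star K = 1 - star R := by
    have := congrArg star hK1
    simpa using this
  have hskew : star K = -K := by
    have hu' : IsUnit (1 + star R) := by simpa using hu.star
    rw [← add_eq_zero_iff_eq_neg]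
    -- Multiplied by `1 + star R` on the left and `1 + R` on the right, `star K + K` becomes `2 • (1
    -- - star R * R)`, which vanishes.
    refine hu'.mul_left_cancel (hu.mul_right_cancel ?_)
    rw [mul_zero, zero_mul, mul_add (1 + star R), add_mul _ _ (1 + R), hK2, mul_assoc _ K, hK1]
    have e : (1 - star R) * (1 + R) + (1 + star R) * (1 - R) = 2 • (1 - star R * R) := by
      noncomm_ring
    rw [e, hR1, sub_self, smul_zero]
  have hKw : K w = 0 := by
    have h1 : (K * (1 + R)) w = (1 - R) w := by rw [hK1]
    have h2 : K (w + R w) = w - R w := h1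
    rw [hRw, sub_self, ← two_smul ℝ w, map_smul] at h2
    simpa using h2
  refine ⟨⟨K, hskew, hKw⟩, rfl, ?_⟩
  have hu2 := isUnit_one_add_of_star_eq_neg hskew
  refine hu2.mul_right_cancel (hu.mul_right_cancel ?_)
  change (1 - K) * Ring.inverse (1 + K) * (1 + K) * (1 + R) = _
  rw [mul_assoc (1 - K), Ring.inverse_mul_cancel _ hu2, mul_one, sub_mul, hK1, mul_assoc R, add_mul,
    hK1]
  noncomm_ring

theorem isCompact_stabilizerGroup (w : H) : IsCompact (stabilizerGroup w) := by
  have : ProperSpace (H →L[ℝ] H) := FiniteDimensional.proper ℝ _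
  refine Metric.isCompact_of_isClosed_isBounded ?_ ?_
  · refine IsClosed.inter (isClosed_eq (by fun_prop) (by fun_prop))
      (IsClosed.inter (isClosed_eq (by fun_prop) (by fun_prop))
        (isClosed_eq (by fun_prop) (by fun_prop)))
  · refine (Metric.isBounded_closedBall (x := 0) (r := 1)).subset fun Q hQ => ?_
    rw [mem_closedBall_zero_iff]
    refine Q.opNorm_le_bound zero_le_one fun x => ?_
    have h1 : ⟪(star Q * Q) x, x⟫_ℝ = ⟪x, x⟫_ℝ := by rw [hQ.1]; rfl
    rw [ContinuousLinearMap.star_eq_adjoint] at h1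
    change ⟪ContinuousLinearMap.adjoint Q (Q x), x⟫_ℝ = _ at h1
    rw [ContinuousLinearMap.adjoint_inner_left, real_inner_self_eq_norm_sq,
      real_inner_self_eq_norm_sq] at h1
    rw [one_mul]
    exact (pow_le_pow_iff_left₀ (norm_nonneg _) (norm_nonneg _) two_ne_zero).1 h1.le

theorem inner_apply_apply_of_mem {w : H} {Q : H →L[ℝ] H} (hQ : Q ∈ stabilizerGroup w) (x y : H) :
    ⟪Q x, Q y⟫_ℝ = ⟪x, y⟫_ℝ := by
  rw [← ContinuousLinearMap.adjoint_inner_left, ← ContinuousLinearMap.star_eq_adjoint]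
  change ⟪(star Q * Q) x, y⟫_ℝ = _
  rw [hQ.1]
  rfl

/-! ### Families with given inner products as a compact orbit -/

/-- Families with the same Gram matrix are related by an isometry. -/
theorem exists_linearIsometry_of_inner_eq {κ : Type*} {v v' : κ → H}
    (h : ∀ i j, ⟪v i, v j⟫_ℝ = ⟪v' i, v' j⟫_ℝ) : ∃ Q : H →ₗᵢ[ℝ] H, ∀ i, Q (v i) = v' i := by
  set f := Finsupp.linearCombination ℝ v
  set g := Finsupp.linearCombination ℝ v'
  have hfg : ∀ c, ‖f c‖ = ‖g c‖ := by
    intro c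
    rw [← sq_eq_sq₀ (norm_nonneg _) (norm_nonneg _), ← real_inner_self_eq_norm_sq,
      ← real_inner_self_eq_norm_sq]
    simp only [f, g, Finsupp.linearCombination_apply, Finsupp.sum, sum_inner, inner_sum,
      inner_smul_left, inner_smul_right, h]
  -- `σ` chooses coefficients for each vector in the span of `v`; by `hfg` the choice does not
  -- affect the resulting combination of `v'`.
  obtain ⟨σ, hσ⟩ := f.rangeRestrict.exists_rightInverse_of_surjective f.range_rangeRestrict
  have hσ' : ∀ y, f (σ y) = y := fun y =>
    congrArg Subtype.val (LinearMap.congr_fun hσ y)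
  let L : LinearMap.range f →ₗᵢ[ℝ] H :=
    ⟨g.comp σ, fun y => by
      rw [LinearMap.comp_apply, ← hfg, hσ']
      rfl⟩
  refine ⟨L.extend, fun i => ?_⟩
  have hi : f (Finsupp.single i 1) = v i := by simp [f]
  have hi' : g (Finsupp.single i 1) = v' i := by simp [g]
  have h1 := L.extend_apply ⟨v i, Finsupp.single i 1, hi⟩
  rw [show L.extend (v i) = _ from h1, ← hi', ← sub_eq_zero, ← norm_eq_zero]
  change ‖g (σ _) - _‖ = 0
  rw [← map_sub, ← hfg, map_sub, hσ', hi, sub_self, norm_zero]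

/-- Transitivity: with `w` adjoined to both families at index `none`, the linear conditions become
part of the Gram matrix. -/
theorem exists_mem_stabilizerGroup {ι : Type*} {w : H} {a x y : ι → H}
    (hx : x ∈ congruentFamilies w a) (hy : y ∈ congruentFamilies w a) :
    ∃ Q ∈ stabilizerGroup w, ∀ i, Q (x i) = y i := by
  obtain ⟨Q, hQ⟩ := exists_linearIsometry_of_inner_eq
    (v := fun o : Option ι => o.elim w x) (v' := fun o : Option ι => o.elim w y) (by
      rintro (_ | i) (_ | j)
      · rfl
      · simp only [Option.elim]
        rw [real_inner_comm, hx.2 j, ← hy.2 j, real_inner_comm]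
      · exact (hx.2 i).trans (hy.2 i).symm
      · exact (hx.1 i j).trans (hy.1 i j).symm)
  have h1 : star Q.toContinuousLinearMap * Q.toContinuousLinearMap = 1 := by
    ext x
    refine ext_inner_right ℝ fun y => ?_
    rw [ContinuousLinearMap.star_eq_adjoint]
    change ⟪ContinuousLinearMap.adjoint Q.toContinuousLinearMap (Q x), y⟫_ℝ = ⟪x, y⟫_ℝ
    rw [ContinuousLinearMap.adjoint_inner_left]
    exact Q.inner_map_map x y
  exact ⟨Q.toContinuousLinearMap, ⟨h1,
    ContinuousLinearMap.mul_eq_one_symm_of_finiteDimensional h1, hQ none⟩, fun i => hQ (some i)⟩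

theorem apply_mem_congruentFamilies {ι : Type*} {w : H} {a x : ι → H}
    (hx : x ∈ congruentFamilies w a) {Q : H →L[ℝ] H} (hQ : Q ∈ stabilizerGroup w) :
    (fun i => Q (x i)) ∈ congruentFamilies w a := by
  refine ⟨fun i j => ?_, fun i => ?_⟩
  · rw [inner_apply_apply_of_mem hQ]
    exact hx.1 i j
  · have := inner_apply_apply_of_mem hQ (x i) w
    rw [hQ.2.2] at this
    rw [this]
    exact hx.2 i

theorem isCompact_congruentFamilies {ι : Type*} [Fintype ι] (w : H) (a : ι → H) :
    IsCompact (congruentFamilies w a) := by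
  have ha : a ∈ congruentFamilies w a := ⟨fun _ _ => rfl, fun _ => rfl⟩
  have : congruentFamilies w a =
      (fun (Q : H →L[ℝ] H) (i : ι) => Q (a i)) '' stabilizerGroup w := by
    ext x
    constructor
    · intro hx
      obtain ⟨Q, hQ, h⟩ := exists_mem_stabilizerGroup ha hx
      exact ⟨Q, hQ, funext h⟩
    · rintro ⟨Q, hQ, rfl⟩
      exact apply_mem_congruentFamilies ha hQ
  rw [this]
  exact (isCompact_stabilizerGroup w).image (by fun_prop)

theorem stabilizerGroup_mul_star {w : H} {Q R : H →L[ℝ] H} (hQ : Q ∈ stabilizerGroup w)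
    (hR : R ∈ stabilizerGroup w) : Q * star R ∈ stabilizerGroup w := by
  refine ⟨?_, ?_, ?_⟩
  · rw [star_mul, star_star, mul_assoc, ← mul_assoc (star Q), hQ.1, one_mul, hR.2.1]
  · rw [star_mul, star_star, mul_assoc, ← mul_assoc (star R), hR.1, one_mul, hQ.2.1]
  · have h1 : star R w = w := by
      have : (star R * R) w = w := by rw [hR.1]; rfl
      change star R (R w) = w at this
      rwa [hR.2.2] at this
    change Q (star R w) = w
    rw [h1, hQ.2.2]

/-- The orbit maps of the group of isometries fixing `w` are open. -/
theorem orbit_mem_nhdsWithin {ι : Type*} [Fintype ι] {w : H} {a x : ι → H}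
    (hx : x ∈ congruentFamilies w a) {N : Set (H →L[ℝ] H)} (hN : N ∈ 𝓝 1) :
    {y | ∃ R ∈ stabilizerGroup w, R ∈ N ∧ ∀ i, R (x i) = y i} ∈ 𝓝[congruentFamilies w a] x := by
  obtain ⟨N', hN'N, hN'o, hN'1⟩ := mem_nhds_iff.1 hN
  -- The isometries outside `N'` times the stabilizer of `x`. They form a compact set not fixing
  -- `x`, so points near `x` are reached only by some `Q` with `Q * star R ∈ N'` and `R` fixing `x`.
  let B : Set (H →L[ℝ] H) := stabilizerGroup w ∩
    ⋂ R ∈ {R | R ∈ stabilizerGroup w ∧ ∀ i, R (x i) = x i}, {Q | Q * star R ∈ N'ᶜ}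
  have hB : IsCompact B := by
    refine (isCompact_stabilizerGroup w).inter_right (isClosed_biInter fun R _ => ?_)
    exact hN'o.isClosed_compl.preimage (by fun_prop)
  have himg : IsClosed ((fun (Q : H →L[ℝ] H) (i : ι) => Q (x i)) '' B) :=
    (hB.image (by fun_prop)).isClosed
  have hxB : x ∉ (fun (Q : H →L[ℝ] H) (i : ι) => Q (x i)) '' B := by
    rintro ⟨Q, ⟨hQ, hQB⟩, hQx⟩
    have := mem_iInter₂.1 hQB Q ⟨hQ, fun i => congrFun hQx i⟩
    change Q * star Q ∉ N' at this
    rw [hQ.2.1] at this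
    exact this hN'1
  filter_upwards [self_mem_nhdsWithin,
    mem_nhdsWithin_of_mem_nhds (himg.isOpen_compl.mem_nhds hxB)] with y hy hyB
  obtain ⟨Q, hQ, hQx⟩ := exists_mem_stabilizerGroup hx hy
  have hQB : Q ∉ B := fun h => hyB ⟨Q, h, funext hQx⟩
  have hex : ∃ R, (R ∈ stabilizerGroup w ∧ ∀ i, R (x i) = x i) ∧ Q * star R ∈ N' := by
    by_contra! hn
    exact hQB ⟨hQ, mem_iInter₂.2 fun R hR => hn R hR⟩
  obtain ⟨R, ⟨hR, hRx⟩, hRN⟩ := hex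
  refine ⟨Q * star R, stabilizerGroup_mul_star hQ hR, hN'N hRN, fun i => ?_⟩
  have h1 : star R (x i) = x i := by
    have : (star R * R) (x i) = x i := by rw [hR.1]; rfl
    change star R (R (x i)) = x i at this
    rwa [hRx i] at this
  change Q (star R (x i)) = y i
  rw [h1, hQx i]

/-! ### Cayley charts on the orbit -/

/-- The differential at the identity of the orbit map at `x`. -/
noncomputable def orbitDifferential {ι : Type*} [Fintype ι] (w : H) (x : ι → H) :
    stabilizerAlgebra w →L[ℝ] (ι → H) :=
  ContinuousLinearMap.pi fun i =>
    (ContinuousLinearMap.apply ℝ H (x i)).comp (stabilizerAlgebra w).subtypeL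

/-- The Cayley transform as a chart of the orbit of `x`. -/
noncomputable def cayleyChart {ι : Type*} (w : H) (x : ι → H) (K : stabilizerAlgebra w) : ι → H :=
  fun i => cayley K.1 (x i)

theorem orbitDifferential_apply {ι : Type*} [Fintype ι] (w : H) (x : ι → H)
    (K : stabilizerAlgebra w) (i : ι) : orbitDifferential w x K i = K.1 (x i) := rfl

theorem continuous_orbitDifferential {ι : Type*} [Fintype ι] (w : H) :
    Continuous (orbitDifferential (ι := ι) w) := by
  refine (continuous_clm_apply (𝕜 := ℝ) (E := stabilizerAlgebra w) (F := ι → H)).2 fun K => ?_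
  refine continuous_pi fun i => ?_
  simp only [orbitDifferential_apply]
  fun_prop

theorem inverse_one_add_apply_of_apply_eq_zero {K : H →L[ℝ] H} (hK : star K = -K) {x : H}
    (hx : K x = 0) : Ring.inverse (1 + K) x = x := by
  have h : (Ring.inverse (1 + K) * (1 + K)) x = x := by
    rw [Ring.inverse_mul_cancel _ (isUnit_one_add_of_star_eq_neg hK)]
    rfl
  change Ring.inverse (1 + K) (x + K x) = x at h
  rwa [hx, add_zero] at h

/-- The right logarithmic derivative of the Cayley transform is an automorphism of the Lie
algebra. -/
theorem exists_equiv_cayley_derivative {w : H} (K : stabilizerAlgebra w) :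
    ∃ D : stabilizerAlgebra w ≃L[ℝ] stabilizerAlgebra w, ∀ δ : stabilizerAlgebra w,
      (-2 : ℝ) • (Ring.inverse (1 + K.1) * δ.1 * Ring.inverse (1 + K.1)) =
        (D δ).1 * cayley K.1 := by
  set P := Ring.inverse (1 + K.1) with hP
  set P' := Ring.inverse (1 + (-K).1) with hP'
  have hu := isUnit_one_add_of_star_eq_neg K.2.1
  have hu' := isUnit_one_add_of_star_eq_neg (-K).2.1
  have hstar : star P = P' := by
    rw [hP, ← Ring.inverse_star, star_add, star_one, K.2.1]
    rfl
  have hstar' : star P' = P := by rw [← hstar, star_star]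
  have hPw : P' w = w := inverse_one_add_apply_of_apply_eq_zero (-K).2.1 (-K).2.2
  -- Since `P'` is the adjoint of `P`, the map δ ↦ -2PδP' preserves skewness; `P'` cancels the
  -- factor `1 - K` of the Cayley transform.
  let L : stabilizerAlgebra w →ₗ[ℝ] stabilizerAlgebra w :=
    LinearMap.codRestrict _
      ((((-2 : ℝ) • ContinuousLinearMap.mulLeftRight ℝ (H →L[ℝ] H) P P').toLinearMap).comp
        (stabilizerAlgebra w).subtype) (by
        intro δ
        change (-2 : ℝ) • (P * δ.1 * P') ∈ _
        refine Submodule.smul_mem _ _ ⟨?_, ?_⟩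
        · rw [star_mul, star_mul, hstar, hstar', δ.2.1]
          noncomm_ring
        · change P (δ.1 (P' w)) = 0
          rw [hPw, δ.2.2, map_zero])
  have hL : ∀ δ, (L δ).1 = (-2 : ℝ) • (P * δ.1 * P') := fun _ => rfl
  have hinj : Function.Injective L := by
    rw [injective_iff_map_eq_zero]
    intro δ hδ
    have h1 : (-2 : ℝ) • (P * δ.1 * P') = 0 := by rw [← hL, hδ]; rfl
    have h2 : P * δ.1 * P' = 0 := (smul_eq_zero.1 h1).resolve_left (by norm_num)
    have h3 : (1 + K.1) * (P * δ.1 * P') * (1 + (-K).1) = δ.1 := by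
      rw [mul_assoc, mul_assoc (P * δ.1), Ring.inverse_mul_cancel _ hu', mul_one, ← mul_assoc,
        Ring.mul_inverse_cancel _ hu, one_mul]
    rw [h2, mul_zero, zero_mul] at h3
    exact Subtype.ext h3.symm
  refine ⟨(LinearEquiv.ofInjectiveEndo L hinj).toContinuousLinearEquiv, fun δ => ?_⟩
  change _ = (L δ).1 * cayley K.1
  have h1 : (1 + (-K).1 : H →L[ℝ] H) = 1 - K.1 := by
    rw [sub_eq_add_neg]
    rfl
  rw [hL, cayley, smul_mul_assoc, mul_assoc _ P', ← mul_assoc P', ← h1,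
    Ring.inverse_mul_cancel _ hu', one_mul]

/-- The charts cover neighbourhoods because orbit maps are open and isometries near the identity are
Cayley transforms of small operators. -/
theorem isChartFamily_cayleyChart {ι : Type*} [Fintype ι] (w : H) (a : ι → H) :
    IsChartFamily (congruentFamilies w a) (orbitDifferential w) (cayleyChart w) where
  map_zero x _ := by
    ext i
    exact (cayley_apply_of_apply_eq_zero (0 : stabilizerAlgebra w).2.1 rfl)
  map_mem x hx K := apply_mem_congruentFamilies hx (cayley_mem_stabilizerGroup K)
  contDiff x _ := by
    rw [contDiff_pi]
    intro i
    exact (contDiff_cayley w).clm_apply contDiff_const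
  fderiv_eq x _ K := by
    obtain ⟨D, hD⟩ := exists_equiv_cayley_derivative K
    refine ⟨D, HasFDerivAt.fderiv ?_⟩
    refine hasFDerivAt_pi'.2 fun i => ?_
    have h1 := (ContinuousLinearMap.apply ℝ H (x i)).hasFDerivAt.comp K (hasFDerivAt_cayley K)
    refine h1.congr_fderiv ?_
    ext δ : 1
    have h2 := congrArg (fun L : H →L[ℝ] H => L (x i)) (hD δ)
    exact h2
  image_mem_nhdsWithin x hx u hu := by
    obtain ⟨u', hu', hsub⟩ := mem_nhds_induced _ _ _ |>.1 hu
    have hcont : ContinuousAt (fun R : H →L[ℝ] H => (1 - R) * Ring.inverse (1 + R)) 1 := by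
      have h2 : IsUnit (1 + 1 : H →L[ℝ] H) := by
        have := (IsUnit.mk0 (2 : ℝ) two_ne_zero).map (algebraMap ℝ (H →L[ℝ] H))
        rwa [map_ofNat, ← one_add_one_eq_two] at this
      obtain ⟨v, hv⟩ := h2
      have h3 : ContinuousAt Ring.inverse (1 + 1 : H →L[ℝ] H) := by
        rw [← hv]
        exact NormedRing.inverse_continuousAt v
      have h4 : ContinuousAt (fun R : H →L[ℝ] H => 1 + R) 1 := by fun_prop
      exact (by fun_prop : ContinuousAt (fun R : H →L[ℝ] H => 1 - R) 1).mul (h3.comp h4)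
    have hN1 : ∀ᶠ R in 𝓝 (1 : H →L[ℝ] H), (1 - R) * Ring.inverse (1 + R) ∈ u' := by
      refine hcont.eventually ?_
      simpa using hu'
    have hN2 : ∀ᶠ R in 𝓝 (1 : H →L[ℝ] H), IsUnit (1 + R) := by
      have h2 : IsUnit (1 + 1 : H →L[ℝ] H) := by
        have := (IsUnit.mk0 (2 : ℝ) two_ne_zero).map (algebraMap ℝ (H →L[ℝ] H))
        rwa [map_ofNat, ← one_add_one_eq_two] at this
      have h4 : ContinuousAt (fun R : H →L[ℝ] H => 1 + R) 1 := by fun_prop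
      exact h4.eventually (Units.isOpen.mem_nhds h2)
    filter_upwards [orbit_mem_nhdsWithin hx (hN1.and hN2)] with y hy
    obtain ⟨R, hR, ⟨hRu, hRunit⟩, hRx⟩ := hy
    obtain ⟨K, hK, hKR⟩ := exists_cayley_eq hR hRunit
    refine ⟨K, hsub ?_, ?_⟩
    · change K.1 ∈ u'
      rw [hK]
      exact hRu
    · ext i
      rw [← hRx i, ← hKR]
      rfl

/-! ### Dimension and kernels of the Lie algebra -/

/-- The infinitesimal rotation in the plane spanned by `u` and `v`, taking `u` towards `v`. -/
noncomputable def infinitesimalRotation (u v : H) : H →L[ℝ] H :=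
  (innerSL ℝ u).smulRight v - (innerSL ℝ v).smulRight u

omit [FiniteDimensional ℝ H] in
theorem infinitesimalRotation_apply (u v x : H) :
    infinitesimalRotation u v x = ⟪u, x⟫_ℝ • v - ⟪v, x⟫_ℝ • u := rfl

theorem infinitesimalRotation_mem {w u v : H} (hu : ⟪u, w⟫_ℝ = 0) (hv : ⟪v, w⟫_ℝ = 0) :
    infinitesimalRotation u v ∈ stabilizerAlgebra w := by
  refine ⟨?_, by simp [infinitesimalRotation_apply, hu, hv]⟩
  ext x
  refine ext_inner_right ℝ fun y => ?_
  rw [ContinuousLinearMap.star_eq_adjoint, ContinuousLinearMap.adjoint_inner_left, neg_apply,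
    infinitesimalRotation_apply, infinitesimalRotation_apply]
  simp only [inner_neg_left, inner_sub_left, inner_sub_right, inner_smul_left, inner_smul_right,
    real_inner_comm, RCLike.conj_to_real]
  ring

/-- The rotations in the coordinate planes of the complement of `w` are independent, being dual to
the matrix entries below the diagonal. The reverse inequality comes from a regular point in
`theorem2`. -/
theorem card_le_finrank_stabilizerAlgebra {w : H} {N : ℕ} (hw : w ≠ 0)
    (hN : Module.finrank ℝ H = N + 1) :
    Fintype.card (Σ l : Fin N, Fin l) ≤ Module.finrank ℝ (stabilizerAlgebra w) := by
  have : Fact (Module.finrank ℝ H = N + 1) := ⟨hN⟩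
  let b₀ : OrthonormalBasis (Fin N) ℝ (ℝ ∙ w)ᗮ :=
    (stdOrthonormalBasis ℝ (ℝ ∙ w)ᗮ).reindex (finCongr (Submodule.finrank_orthogonal_span_singleton hw))
  let b : Fin N → H := fun i => b₀ i
  have hb : ∀ i, ⟪b i, w⟫_ℝ = 0 := fun i => by
    rw [real_inner_comm]
    exact Submodule.mem_orthogonal_singleton_iff_inner_right.1 (b₀ i).2
  have ho : ∀ i j, ⟪b i, b j⟫_ℝ = if i = j then 1 else 0 := fun i j =>
    orthonormal_iff_ite.1 b₀.orthonormal i j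
  let e : (Σ l : Fin N, Fin l) → stabilizerAlgebra w := fun p =>
    ⟨infinitesimalRotation (b (Fin.castLE p.1.2.le p.2)) (b p.1),
      infinitesimalRotation_mem (hb _) (hb _)⟩
  let f : (Σ l : Fin N, Fin l) → Module.Dual ℝ (stabilizerAlgebra w) := fun p =>
    (innerₛₗ ℝ (b p.1)).comp
      ((ContinuousLinearMap.apply ℝ H (b (Fin.castLE p.1.2.le p.2))).toLinearMap.comp
        (stabilizerAlgebra w).subtype)
  have hfe : ∀ p q, f p (e q) = if p = q then 1 else 0 := by
    rintro ⟨l, k⟩ ⟨l', k'⟩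
    have h1 : f ⟨l, k⟩ (e ⟨l', k'⟩) = ⟪b l, infinitesimalRotation
      (b (Fin.castLE l'.2.le k')) (b l') (b (Fin.castLE l.2.le k))⟫_ℝ := rfl
    rw [h1, infinitesimalRotation_apply, inner_sub_right, inner_smul_right, inner_smul_right,
      ho, ho, ho, ho]
    have hk := k.2
    have hk' := k'.2
    by_cases h : l = l'
    · subst h
      by_cases h' : k = k'
      · subst h'
        have : l ≠ Fin.castLE l.2.le k := fun h => by
          have := congrArg Fin.val h
          simp at this
          omega
        simp [this]
      · have : Fin.castLE l.2.le k' ≠ Fin.castLE l.2.le k := fun h => h' (by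
          have := congrArg Fin.val h
          exact Fin.ext this.symm)
        have h2 : l ≠ Fin.castLE l.2.le k := fun h => by
          have := congrArg Fin.val h
          simp at this
          omega
        simp [this, h', h2]
    · have h2 : ¬ (l' = Fin.castLE l.2.le k ∧ l = Fin.castLE l'.2.le k') := by
        rintro ⟨h2, h3⟩
        have h2 := congrArg Fin.val h2
        have h3 := congrArg Fin.val h3
        simp at h2 h3
        omega
      have h4 : (⟨l, k⟩ : Σ l : Fin N, Fin l) ≠ ⟨l', k'⟩ := fun h' => h (congrArg Sigma.fst h')
      rw [if_neg h, if_neg h4, mul_zero, zero_sub, neg_eq_zero, mul_eq_zero]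
      by_contra! hc
      simp only [ne_eq, ite_eq_right_iff, one_ne_zero, imp_false, not_not] at hc
      exact h2 hc
  have hli : LinearIndependent ℝ e := by
    rw [Fintype.linearIndependent_iff]
    intro g hg p
    have := congrArg (f p) hg
    simpa [map_sum, hfe] using this
  exact hli.fintype_card_le_finrank

/-- The complement of `P` is invariant and at most a line, and a skew operator on a line is zero. -/
theorem eq_zero_of_finrank_ker {K : H →L[ℝ] H} (hK : star K = -K) {N : ℕ}
    (hN : Module.finrank ℝ H = N + 1) {P : Submodule ℝ H} (hP : N ≤ Module.finrank ℝ P)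
    (hPK : ∀ x ∈ P, K x = 0) : K = 0 := by
  have h1 : Module.finrank ℝ Pᗮ ≤ 1 := by
    have := P.finrank_add_finrank_orthogonal
    omega
  obtain ⟨v, hv⟩ := finrank_le_one_iff.1 h1
  have hperp : ∀ u ∈ Pᗮ, K u = 0 := by
    intro u hu
    have hKu : K u ∈ Pᗮ := by
      rw [Submodule.mem_orthogonal']
      intro p hp
      rw [inner_apply_left_of_star_eq_neg hK, hPK p hp, inner_zero_right, neg_zero]
    obtain ⟨c, hc⟩ := hv ⟨u, hu⟩
    obtain ⟨c', hc'⟩ := hv ⟨K u, hKu⟩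
    have hc : c • (v : H) = u := congrArg Subtype.val hc
    have hc' : c' • (v : H) = K u := congrArg Subtype.val hc'
    have h2 := inner_apply_self_of_star_eq_neg hK u
    rw [← hc', ← hc, inner_smul_left, inner_smul_right] at h2
    simp only [conj_trivial, mul_eq_zero, inner_self_eq_zero] at h2
    rw [← hc']
    rcases h2 with h2 | h2 | h2
    · rw [h2, zero_smul]
    · rw [h2, zero_smul] at hc
      rw [hc', ← hc, map_zero]
    · rw [h2, smul_zero]
  ext x
  have hx : x ∈ P ⊔ Pᗮ := by rw [Submodule.sup_orthogonal_of_hasOrthogonalProjection]; trivial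
  obtain ⟨p, hp, u, hu, rfl⟩ := Submodule.mem_sup.1 hx
  rw [map_add, hPK p hp, hperp u hu, add_zero]
  rfl

/-! ### General position by small rotations -/

omit [FiniteDimensional ℝ H] in
theorem finrank_span_insert_image {κ : Type*} {w : H} {v : κ → H}
    (h : LinearIndependent ℝ fun o : Option κ => o.elim w v) (s : Finset κ) :
    Module.finrank ℝ (Submodule.span ℝ (insert w (v '' s))) = s.card + 1 := by
  have h1 := h.comp (Option.map (Subtype.val : s → κ)) (Option.map_injective Subtype.val_injective)
  have h2 := finrank_span_eq_card h1
  rw [Fintype.card_option, Fintype.card_coe] at h2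
  rw [← h2]
  refine congrArg (fun s : Set H => Module.finrank ℝ (Submodule.span ℝ s)) ?_
  ext y
  constructor
  · rintro (rfl | ⟨i, hi, rfl⟩)
    · exact ⟨none, rfl⟩
    · exact ⟨some ⟨i, hi⟩, rfl⟩
  · rintro ⟨_ | i, rfl⟩
    · exact Or.inl rfl
    · exact Or.inr ⟨i, i.2, rfl⟩

omit [FiniteDimensional ℝ H] in
theorem map_span_insert_image {ι : Type*} {w : H} {Q : H →L[ℝ] H} (hQ : Q w = w) (x : ι → H)
    (t : Set ι) : Submodule.span ℝ (insert w ((fun i => Q (x i)) '' t)) =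
      (Submodule.span ℝ (insert w (x '' t))).map Q.toLinearMap := by
  rw [Submodule.map_span, image_insert_eq, image_image]
  congr 2
  exact hQ.symm

/-- If the span of `w` and some of the vectors `x i` is not in general position with respect to
`F`, an arbitrarily small rotation about `w` improves the situation. -/
theorem exists_lt_sup {ι : Type*} [Fintype ι] {w : H} {x a : ι → H}
    (hx : x ∈ congruentFamilies w a) (t : Set ι) {F : Submodule ℝ H}
    (hdim : Module.finrank ℝ H + 1 ≤
      Module.finrank ℝ (Submodule.span ℝ (insert w (x '' t))) + Module.finrank ℝ F)
    (htop : Submodule.span ℝ (insert w (x '' t)) ⊔ F ≠ ⊤) {O : Set (ι → H)} (hO : O ∈ 𝓝 x) :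
    ∃ y ∈ congruentFamilies w a, y ∈ O ∧
      Submodule.span ℝ (insert w (x '' t)) ⊔ F < Submodule.span ℝ (insert w (y '' t)) ⊔ F := by
  set P := Submodule.span ℝ (insert w (x '' t)) with hP
  have hwP : w ∈ P := Submodule.subset_span (mem_insert _ _)
  -- As `P ⊔ F` is proper, the dimension count makes `P ⊓ F` at least a plane, which contains a unit
  -- vector orthogonal to `w`.
  obtain ⟨z, hzP, hzF, hzw, hz⟩ : ∃ z ∈ P, z ∈ F ∧ ⟪z, w⟫_ℝ = 0 ∧ ‖z‖ = 1 := by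
    have h1 := Submodule.finrank_sup_add_finrank_inf_eq P F
    have h2 := Submodule.finrank_lt htop
    have h3 : Module.finrank ℝ ℝ < Module.finrank ℝ ↥(P ⊓ F) := by
      rw [Module.finrank_self]
      omega
    have h4 := LinearMap.ker_ne_bot_of_finrank_lt (f := (innerₛₗ ℝ w).domRestrict (P ⊓ F)) h3
    obtain ⟨⟨z, hzP, hzF⟩, hzk, hz0⟩ := Submodule.exists_mem_ne_zero_of_ne_bot h4
    have hz0 : z ≠ 0 := fun h => hz0 (Subtype.ext h)
    have hzw : ⟪w, z⟫_ℝ = 0 := hzk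
    refine ⟨(‖z‖⁻¹ : ℝ) • z, P.smul_mem _ hzP, F.smul_mem _ hzF, ?_, norm_smul_inv_norm hz0⟩
    rw [inner_smul_left, real_inner_comm, hzw, mul_zero]
  obtain ⟨v, hvP, hv⟩ : ∃ v ∈ (P ⊔ F)ᗮ, ‖v‖ = 1 := by
    have h1 : (P ⊔ F)ᗮ ≠ ⊥ := fun h => htop ((Submodule.orthogonal_eq_bot_iff).1 h)
    obtain ⟨v, hv, hv0⟩ := Submodule.exists_mem_ne_zero_of_ne_bot h1
    exact ⟨(‖v‖⁻¹ : ℝ) • v, Submodule.smul_mem _ _ hv, norm_smul_inv_norm hv0⟩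
  have hvorth : ∀ p ∈ P ⊔ F, ⟪v, p⟫_ℝ = 0 := (Submodule.mem_orthogonal' _ _).1 hvP
  have hvz : ⟪v, z⟫_ℝ = 0 := hvorth z (Submodule.mem_sup_left hzP)
  have hzz : ⟪z, z⟫_ℝ = 1 := by rw [real_inner_self_eq_norm_sq, hz, one_pow]
  have hvv : ⟪v, v⟫_ℝ = 1 := by rw [real_inner_self_eq_norm_sq, hv, one_pow]
  let K : stabilizerAlgebra w := ⟨infinitesimalRotation z v,
    infinitesimalRotation_mem hzw (hvorth w (Submodule.mem_sup_left hwP))⟩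
  have hKapp : ∀ y, K.1 y = ⟪z, y⟫_ℝ • v - ⟪v, y⟫_ℝ • z := fun y => rfl
  have hch := isChartFamily_cayleyChart w a
  obtain ⟨s, hs, hsO⟩ : ∃ s : ℝ, 0 < s ∧ cayleyChart w x (s • K) ∈ O := by
    have hc : ContinuousAt (fun s : ℝ => cayleyChart w x (s • K)) 0 :=
      ((hch.contDiff x hx).continuous.comp (by fun_prop)).continuousAt
    have h0 : cayleyChart w x ((0 : ℝ) • K) = x := by rw [zero_smul]; exact hch.map_zero x hx
    have h1 : ∀ᶠ s in 𝓝 (0 : ℝ), cayleyChart w x (s • K) ∈ O := by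
      refine hc.eventually ?_
      simp only [h0]
      exact hO
    have h2 : ∀ᶠ s in 𝓝[>] (0 : ℝ), cayleyChart w x (s • K) ∈ O := nhdsWithin_le_nhds h1
    obtain ⟨s, hs, hs'⟩ := (h2.and self_mem_nhdsWithin).exists
    exact ⟨s, hs', hs⟩
  refine ⟨_, hch.map_mem x hx (s • K), hsO, ?_⟩
  set R := cayley (s • K).1 with hR
  have hskew := (s • K).2.1
  have hsK : ∀ y, (s • K).1 y = s • K.1 y := fun y => rfl
  have hmap : Submodule.span ℝ (insert w (cayleyChart w x (s • K) '' t)) =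
      P.map R.toLinearMap :=
    map_span_insert_image (cayley_apply_of_apply_eq_zero hskew (s • K).2.2) x t
  rw [hmap]
  -- This is `cayley_apply_add` at `z - s • v`.
  have hRz : R ((1 + s ^ 2) • z) = (1 - s ^ 2) • z - (2 * s) • v := by
    have h1 := cayley_apply_add hskew (z - s • v)
    have h2 : (s • K).1 (z - s • v) = s • v + s ^ 2 • z := by
      rw [hsK, hKapp]
      simp only [inner_sub_right, inner_smul_right, hzz, hvz, hvv, real_inner_comm v z]
      module
    rw [h2] at h1
    convert h1 using 1
    · congr 1
      module
    · module
  -- The part of `P` orthogonal to `z` is fixed by `R`, and `z` itself lies in `F`, so nothing is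
  -- lost; the image of `z` contributes the new direction `v`.
  refine lt_of_le_of_ne (sup_le (fun p hp => ?_) le_sup_right) fun heq => ?_
  · have hp' : p - ⟪z, p⟫_ℝ • z ∈ P := P.sub_mem hp (P.smul_mem _ hzP)
    have hfix : R (p - ⟪z, p⟫_ℝ • z) = p - ⟪z, p⟫_ℝ • z := by
      refine cayley_apply_of_apply_eq_zero hskew ?_
      rw [hsK, hKapp, hvorth _ (Submodule.mem_sup_left hp'), inner_sub_right, inner_smul_right,
        hzz]
      simp
    rw [← sub_add_cancel p (⟪z, p⟫_ℝ • z)]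
    refine Submodule.add_mem _ (Submodule.mem_sup_left ?_)
      (Submodule.mem_sup_right (F.smul_mem _ hzF))
    exact ⟨_, hp', hfix⟩
  · have hmem : (2 * s) • v ∈ P ⊔ F := by
      have h1 : (2 * s) • v = (1 - s ^ 2) • z - R ((1 + s ^ 2) • z) := by rw [hRz]; abel
      rw [h1, heq]
      exact Submodule.sub_mem _ (Submodule.mem_sup_right (F.smul_mem _ hzF))
        (Submodule.mem_sup_left ⟨_, P.smul_mem _ hzP, rfl⟩)
    have := hvorth _ hmem
    rw [inner_smul_right, hvv] at this
    linarith

theorem finrank_span_insert_image_le {ι : Type*} {w : H} {x a : ι → H}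
    (hx : x ∈ congruentFamilies w a) (t : Set ι) :
    Module.finrank ℝ (Submodule.span ℝ (insert w (a '' t))) ≤
      Module.finrank ℝ (Submodule.span ℝ (insert w (x '' t))) := by
  have ha : a ∈ congruentFamilies w a := ⟨fun _ _ => rfl, fun _ => rfl⟩
  obtain ⟨Q, hQ, hQx⟩ := exists_mem_stabilizerGroup hx ha
  rw [← funext hQx, map_span_insert_image hQ.2.2]
  exact Submodule.finrank_map_le _ _

/-- The span of `w` and some of the vectors of a generic family with given Gram matrix is in general
position with respect to `F`. -/
theorem exists_sup_eq_top {ι : Type*} [Fintype ι] {w : H} {a : ι → H}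
    (t : Set ι) {F : Submodule ℝ H}
    (hdim : Module.finrank ℝ H + 1 ≤
      Module.finrank ℝ (Submodule.span ℝ (insert w (a '' t))) + Module.finrank ℝ F)
    {O : Set (ι → H)} (hO : IsOpen O) {x : ι → H} (hx : x ∈ congruentFamilies w a) (hxO : x ∈ O) :
    ∃ y ∈ congruentFamilies w a, y ∈ O ∧ Submodule.span ℝ (insert w (y '' t)) ⊔ F = ⊤ := by
  induction hd : Module.finrank ℝ H -
    Module.finrank ℝ ↥(Submodule.span ℝ (insert w (x '' t)) ⊔ F) using Nat.strong_induction_on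
    generalizing x with
  | _ d ih =>
    by_cases htop : Submodule.span ℝ (insert w (x '' t)) ⊔ F = ⊤
    · exact ⟨x, hx, hxO, htop⟩
    have hle := finrank_span_insert_image_le hx t
    obtain ⟨y, hy, hyO, hlt⟩ := exists_lt_sup hx t (by omega) htop (hO.mem_nhds hxO)
    have h1 := Submodule.finrank_lt_finrank_of_lt hlt
    have h2 := Submodule.finrank_lt htop
    exact ih _ (by omega) hy hyO rfl

/-- The orthogonal complement of the sum is the kernel of an operator `Ψ x` continuous in `x`, and
injectivity is an open condition. -/
theorem isOpen_setOf_sup_eq_top {ι : Type*} [Fintype ι] {w : H} (t : Set ι) {F : Submodule ℝ H}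
    (hwF : w ∈ F) : IsOpen {x : ι → H | Submodule.span ℝ (insert w (x '' t)) ⊔ F = ⊤} := by
  classical
  let Ψ : (ι → H) → H →L[ℝ] ((t → ℝ) × F) := fun x =>
    (ContinuousLinearMap.pi fun i : t => innerSL ℝ (x i)).prod F.orthogonalProjectionOnto
  have hΨ : Continuous Ψ := by
    refine (continuous_clm_apply (𝕜 := ℝ) (E := H) (F := (t → ℝ) × F)).2 fun y => ?_
    refine Continuous.prodMk (continuous_pi fun i => ?_) continuous_const
    exact Continuous.inner (continuous_apply _) continuous_const
  convert ContinuousLinearMap.isOpen_injective.preimage hΨ using 1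
  ext x
  have hker : ∀ y, Ψ x y = 0 ↔ y ∈ (Submodule.span ℝ (insert w (x '' t)) ⊔ F)ᗮ := by
    intro y
    rw [← Submodule.inf_orthogonal, Submodule.mem_inf, Prod.ext_iff]
    change (fun i : t => ⟪x i, y⟫_ℝ) = 0 ∧ F.orthogonalProjectionOnto y = 0 ↔ _
    rw [Submodule.orthogonalProjectionOnto_eq_zero_iff]
    refine and_congr_left fun hy => ?_
    constructor
    · intro h
      rw [Submodule.mem_orthogonal]
      intro p hp
      induction hp using Submodule.span_induction with
      | mem p hp =>
        rcases hp with rfl | ⟨i, hi, rfl⟩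
        · exact (Submodule.mem_orthogonal _ _).1 hy _ hwF
        · exact congrFun h ⟨i, hi⟩
      | zero => exact inner_zero_left _
      | add p q _ _ hp hq => rw [inner_add_left, hp, hq, add_zero]
      | smul c p _ hp => rw [inner_smul_left, hp, mul_zero]
    · intro h
      ext i
      exact (Submodule.mem_orthogonal _ _).1 h _
        (Submodule.subset_span (Or.inr ⟨i, i.2, rfl⟩))
  rw [mem_preimage, mem_ofPred_eq, mem_ofPred_eq, ← Submodule.orthogonal_eq_bot_iff,
    injective_iff_map_eq_zero, Submodule.eq_bot_iff]
  exact forall_congr' fun y => by rw [hker]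

/-- A skew-adjoint operator is determined by its strictly triangular part with respect to two
flags in general position. -/
theorem apply_eq_zero_of_triangular {w : H} {K : H →L[ℝ] H} (hK : K ∈ stabilizerAlgebra w)
    {M N : ℕ} (v : Fin M → H) (u : Fin N → H)
    (h : ∀ k l, k.val < l.val → ⟪K (v k), u l⟫_ℝ = 0)
    (htop : ∀ k, Submodule.span ℝ (insert w (v '' Iic k)) ⊔
      Submodule.span ℝ (insert w (u '' {l | k.val < l.val})) = ⊤) (k : Fin M) : K (v k) = 0 := by
  induction k using WellFoundedLT.induction with
  | _ k ih =>
    -- `K (v k)` is orthogonal to `w` and to the earlier `v i`, which `K` kills, to `v k` by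
    -- skewness, and to the later `u l` by hypothesis; these vectors span.
    have hperp : (⊤ : Submodule ℝ H) ≤ (ℝ ∙ K (v k))ᗮ := by
      rw [← htop k, sup_le_iff, Submodule.span_le, Submodule.span_le, insert_subset_iff,
        insert_subset_iff]
      have hw : w ∈ (ℝ ∙ K (v k))ᗮ := by
        rw [Submodule.mem_orthogonal_singleton_iff_inner_right,
          inner_apply_left_of_star_eq_neg hK.1, hK.2, inner_zero_right, neg_zero]
      refine ⟨⟨hw, ?_⟩, hw, ?_⟩
      · rintro _ ⟨i, hi, rfl⟩
        rw [SetLike.mem_coe, Submodule.mem_orthogonal_singleton_iff_inner_right]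
        rcases (show i ≤ k from hi).lt_or_eq with hik | rfl
        · rw [inner_apply_left_of_star_eq_neg hK.1, ih i hik, inner_zero_right, neg_zero]
        · exact inner_apply_self_of_star_eq_neg hK.1 _
      · rintro _ ⟨l, hl, rfl⟩
        rw [SetLike.mem_coe, Submodule.mem_orthogonal_singleton_iff_inner_right]
        exact h k l hl
    have := hperp (Submodule.mem_top (x := K (v k)))
    rwa [Submodule.mem_orthogonal_singleton_iff_inner_right, inner_self_eq_zero] at this

/-- Generic families with given Gram matrix are regular points for the coordinates `⟪y (r k), u l⟫`
with `k < l`. -/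
theorem exists_regular {ι : Type*} [Fintype ι] {w : H} {a : ι → H} {N : ℕ}
    (hN : Module.finrank ℝ H = N + 1) {r : Fin (N - 1) → ι} {u : Fin N → H}
    (hr : LinearIndependent ℝ fun o : Option (Fin (N - 1)) => o.elim w (a ∘ r))
    (hu : LinearIndependent ℝ fun o : Option (Fin N) => o.elim w u)
    {x : ι → H} (hx : x ∈ congruentFamilies w a) {O : Set (ι → H)} (hO : O ∈ 𝓝 x) :
    ∃ y ∈ congruentFamilies w a, y ∈ O ∧ ∀ K ∈ stabilizerAlgebra w,
      (∀ k l, k.val < l.val → ⟪K (y (r k)), u l⟫_ℝ = 0) → K = 0 := by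
  classical
  let P (y : ι → H) (k : Fin (N - 1)) := Submodule.span ℝ (insert w (y '' (r '' Iic k)))
  let F (k : Fin (N - 1)) := Submodule.span ℝ (insert w (u '' {l | k.val < l.val}))
  have hwF : ∀ k, w ∈ F k := fun k => Submodule.subset_span (mem_insert _ _)
  -- The dimensions are k + 2 and N - k; the extra 1 accounts for the common vector `w`.
  have hdim : ∀ k, Module.finrank ℝ H + 1 ≤ Module.finrank ℝ (P a k) + Module.finrank ℝ (F k) := by
    intro k
    have h1 := finrank_span_insert_image hr (Finset.Iic k)
    have h2 := finrank_span_insert_image hu (Finset.univ.filter fun l : Fin N => k.val < l.val)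
    have h3 : P a k = Submodule.span ℝ (insert w ((a ∘ r) '' (Finset.Iic k : Finset _))) := by
      rw [image_comp, Finset.coe_Iic]
    have h4 : F k = Submodule.span ℝ (insert w
        (u '' (Finset.univ.filter fun l : Fin N => k.val < l.val : Finset _))) := by
      rw [Finset.coe_filter]
      simp only [Finset.mem_univ, true_and]
      rfl
    have h5 : (Finset.univ.filter fun l : Fin N => k.val < l.val) =
        Finset.Ioi (⟨k.val, by omega⟩ : Fin N) := by
      ext l
      simp [Fin.lt_def]
    rw [h3, h4, h1, h2, h5, hN, Fin.card_Iic, Fin.card_Ioi]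
    have := k.2
    simp only
    omega
  -- The conditions are imposed one at a time; being open, those already achieved survive a further
  -- small move.
  have hgen : ∀ s : Finset (Fin (N - 1)), ∃ y ∈ congruentFamilies w a, y ∈ interior O ∧
      ∀ k ∈ s, P y k ⊔ F k = ⊤ := by
    intro s
    induction s using Finset.induction_on with
    | empty => exact ⟨x, hx, mem_interior_iff_mem_nhds.2 hO, by simp⟩
    | insert k s _ ih =>
      obtain ⟨y, hy, hyO, hys⟩ := ih
      have hopen : IsOpen (interior O ∩ ⋂ k ∈ s, {y | P y k ⊔ F k = ⊤}) :=
        isOpen_interior.inter (isOpen_biInter_finset fun k _ => isOpen_setOf_sup_eq_top _ (hwF k))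
      obtain ⟨y', hy', hyO', htop⟩ := exists_sup_eq_top (r '' Iic k) (hdim k) hopen hy
        ⟨hyO, mem_iInter₂.2 hys⟩
      refine ⟨y', hy', hyO'.1, fun k' hk' => ?_⟩
      rcases Finset.mem_insert.1 hk' with rfl | hk'
      · exact htop
      · exact mem_iInter₂.1 hyO'.2 k' hk'
  obtain ⟨y, hy, hyO, hytop⟩ := hgen Finset.univ
  refine ⟨y, hy, interior_subset hyO, fun K hK hKu => ?_⟩
  have hzero := apply_eq_zero_of_triangular hK (y ∘ r) u hKu fun k => by
    rw [image_comp]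
    exact hytop k (Finset.mem_univ k)
  have hrank : N ≤ Module.finrank ℝ (Submodule.span ℝ (insert w (y '' range r))) := by
    refine le_trans ?_ (finrank_span_insert_image_le hy (range r))
    have h1 := finrank_span_insert_image hr Finset.univ
    rw [Finset.coe_univ, image_comp, image_univ, Finset.card_univ, Fintype.card_fin] at h1
    omega
  refine eq_zero_of_finrank_ker hK.1 hN hrank fun z hz => ?_
  have hle : Submodule.span ℝ (insert w (y '' range r)) ≤ LinearMap.ker K.toLinearMap := by
    rw [Submodule.span_le, insert_subset_iff]
    refine ⟨hK.2, ?_⟩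
    rintro _ ⟨_, ⟨k, rfl⟩, rfl⟩
    exact hzero k
  exact hle hz

/-- Only the zero element of the Lie algebra fixes a family with given Gram matrix of corank at
most one, infinitesimally. -/
theorem eq_zero_of_forall_apply_eq_zero {ι : Type*} {w : H} {x a : ι → H}
    (hx : x ∈ congruentFamilies w a) {N : ℕ} (hN : Module.finrank ℝ H = N + 1)
    (ha : N ≤ Module.finrank ℝ (Submodule.span ℝ (insert w (range a))))
    {K : H →L[ℝ] H} (hK : K ∈ stabilizerAlgebra w) (h : ∀ i, K (x i) = 0) : K = 0 := by
  have hrank := finrank_span_insert_image_le hx univ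
  rw [image_univ, image_univ] at hrank
  refine eq_zero_of_finrank_ker hK.1 hN (ha.trans hrank) fun z hz => ?_
  have hle : Submodule.span ℝ (insert w (range x)) ≤ LinearMap.ker K.toLinearMap := by
    rw [Submodule.span_le, insert_subset_iff]
    refine ⟨hK.2, ?_⟩
    rintro _ ⟨i, rfl⟩
    exact h i
  exact hle hz

omit [FiniteDimensional ℝ H] in
/-- Choice of the vectors of a family which, together with `w`, span the same space. -/
theorem exists_linearIndependent_option {ι : Type*} [Finite ι] {w : H} (hw : w ≠ 0) {a : ι → H}
    {M : ℕ} (hM : M ≤ Module.finrank ℝ (Submodule.span ℝ (insert w (range a))) - 1) :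
    ∃ r : Fin M → ι, Function.Injective r ∧
      LinearIndependent ℝ fun o : Option (Fin M) => o.elim w (a ∘ r) := by
  let q := (ℝ ∙ w).mkQ
  obtain ⟨κ, c, hc, hspan, hli⟩ := exists_linearIndependent' ℝ (q ∘ a)
  have : Finite κ := Finite.of_injective c hc
  cases nonempty_fintype κ
  have hcard : M ≤ Fintype.card κ := by
    have hle : Submodule.span ℝ (insert w (range a)) ≤
        Submodule.span ℝ (range (a ∘ c)) ⊔ (ℝ ∙ w) := by
      rw [Submodule.span_le, insert_subset_iff]
      refine ⟨Submodule.mem_sup_right (Submodule.mem_span_singleton_self w), ?_⟩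
      rintro _ ⟨i, rfl⟩
      have h1 : q (a i) ∈ (Submodule.span ℝ (range (a ∘ c))).map q := by
        rw [Submodule.map_span, ← range_comp, ← Function.comp_assoc, hspan]
        exact Submodule.subset_span ⟨i, rfl⟩
      obtain ⟨b, hb, hbi⟩ := h1
      have h2 : a i - b ∈ (ℝ ∙ w) := by
        rw [← Submodule.ker_mkQ (ℝ ∙ w), LinearMap.mem_ker, map_sub, sub_eq_zero]
        exact hbi.symm
      rw [← add_sub_cancel b (a i)]
      exact Submodule.add_mem _ (Submodule.mem_sup_left hb) (Submodule.mem_sup_right h2)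
    have : FiniteDimensional ℝ (Submodule.span ℝ (range (a ∘ c))) :=
      FiniteDimensional.span_of_finite ℝ (finite_range _)
    have h1 := Submodule.finrank_mono hle
    have h2 := Submodule.finrank_add_le_finrank_add_finrank
      (Submodule.span ℝ (range (a ∘ c))) (ℝ ∙ w)
    have h3 : Module.finrank ℝ (Submodule.span ℝ (range (a ∘ c))) ≤ _ :=
      finrank_range_le_card (R := ℝ) (a ∘ c)
    rw [finrank_span_singleton hw] at h2
    omega
  obtain ⟨e⟩ : Nonempty (Fin M ↪ κ) := by
    rw [Function.Embedding.nonempty_iff_card_le, Fintype.card_fin]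
    exact hcard
  refine ⟨c ∘ e, hc.comp e.injective, ?_⟩
  have hli' : LinearIndependent ℝ (q ∘ (a ∘ c ∘ e)) := hli.comp e e.injective
  rw [linearIndependent_option]
  refine ⟨hli'.of_comp q, fun hmem => ?_⟩
  change w ∈ Submodule.span ℝ (range (a ∘ c ∘ e)) at hmem
  obtain ⟨g, hg⟩ := (Submodule.mem_span_range_iff_exists_fun ℝ).1 hmem
  have h1 := congrArg q hg
  have h2 : q w = 0 := (Submodule.Quotient.mk_eq_zero _).2 (Submodule.mem_span_singleton_self w)
  rw [map_sum, h2] at h1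
  simp only [map_smul] at h1
  have h3 := Fintype.linearIndependent_iff.1 hli' g h1
  apply hw
  rw [← hg]
  exact Finset.sum_eq_zero fun i _ => by rw [h3 i, zero_smul]

end Stabilizer

/-! ### Translation to matrices and conclusion -/

theorem ForGeneric.of_homeomorph {m n : ℕ} {M : Type*} [TopologicalSpace M]
    (e : Matrix (Fin m) (Fin n) ℝ ≃ₜ M) {V : Set (Matrix (Fin m) (Fin n) ℝ)} {V' : Set M}
    (hV : ∀ X, X ∈ V ↔ e X ∈ V') {P : Matrix (Fin m) (Fin n) ℝ → Prop} {P' : M → Prop}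
    (hP : ∀ X, P' (e X) → P X)
    (h : ∃ U : Set V', IsOpen U ∧ Dense U ∧ ∀ x ∈ U, P' x.1) : ForGeneric V P := by
  obtain ⟨U, hU, hUd, hUP⟩ := h
  let e' : V ≃ₜ V' := e.subtype hV
  exact ⟨e' ⁻¹' U, hU.preimage e'.continuous, hUd.preimage e'.isOpenMap,
    fun X hX => hP X (hUP _ hX)⟩

/-- Matrices as families of vectors of a Euclidean space. -/
noncomputable def rowsHomeomorph (m n : ℕ) :
    Matrix (Fin m) (Fin n) ℝ ≃ₜ (Fin m → EuclideanSpace ℝ (Fin n)) :=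
  (ContinuousLinearEquiv.piCongrRight fun _ : Fin m =>
    (EuclideanSpace.equiv (Fin n) ℝ).symm).toHomeomorph

theorem rowsHomeomorph_apply {m n : ℕ} (X : Matrix (Fin m) (Fin n) ℝ) (i : Fin m) :
    rowsHomeomorph m n X i = WithLp.toLp 2 (X i) := rfl

theorem mem_solutionSet_iff {m n : ℕ} (A X : Matrix (Fin m) (Fin n) ℝ) (W : Fin n → ℝ) :
    X ∈ solutionSet (A * Aᵀ) W (A *ᵥ W) ↔
      rowsHomeomorph m n X ∈ congruentFamilies (WithLp.toLp 2 W) (rowsHomeomorph m n A) := by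
  refine and_congr ?_ ?_
  · rw [← Matrix.ext_iff]
    simp only [rowsHomeomorph_apply, EuclideanSpace.inner_toLp_toLp, star_trivial,
      Matrix.mul_apply']
    exact forall₂_congr fun i j => by
      rw [dotProduct_comm, dotProduct_comm (A i)]
      rfl
  · rw [funext_iff]
    simp only [rowsHomeomorph_apply, EuclideanSpace.inner_toLp_toLp, star_trivial]
    exact forall_congr' fun i => by
      rw [dotProduct_comm W, dotProduct_comm W]
      rfl

theorem HasIndependentRows.le_finrank_span {m n k : ℕ} {A : Matrix (Fin m) (Fin n) ℝ}
    {W : Fin n → ℝ} (h : HasIndependentRows (augmented A W) k) :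
    k ≤ Module.finrank ℝ (Submodule.span ℝ
      (insert (WithLp.toLp 2 W) (range (rowsHomeomorph m n A)))) := by
  obtain ⟨s, hs, hli⟩ := h
  have h1 := hli.map' (WithLp.linearEquiv 2 ℝ (Fin n → ℝ)).symm.toLinearMap
    (LinearEquiv.ker _)
  have h2 := finrank_span_eq_card h1
  rw [Fintype.card_coe] at h2
  rw [← h2] at hs
  refine hs.trans (Submodule.finrank_mono (Submodule.span_mono ?_))
  rintro _ ⟨⟨i | i, hi⟩, rfl⟩
  · exact Or.inr ⟨i, rfl⟩
  · exact Or.inl rfl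

/-- Only `W` has a nonzero coordinate at `j`. Inner products with the remaining basis vectors are
matrix entries. -/
theorem linearIndependent_option_single_succAbove {N : ℕ} {W : Fin (N + 1) → ℝ} {j : Fin (N + 1)}
    (hj : W j ≠ 0) : LinearIndependent ℝ fun o : Option (Fin N) => o.elim (WithLp.toLp 2 W)
      fun l => EuclideanSpace.single (j.succAbove l) (1 : ℝ) := by
  rw [Fintype.linearIndependent_iff]
  intro g hg
  have hcoord : ∀ i, g none * W i + ∑ l, g (some l) * (if i = j.succAbove l then 1 else 0) = 0 := by
    intro i
    have := congrArg (fun v : EuclideanSpace ℝ (Fin (N + 1)) => v i) hg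
    simpa [Fintype.sum_option, Pi.single_apply] using this
  have hnone : g none = 0 := by
    have := hcoord j
    simpa [(Fin.succAbove_ne j _).symm, hj] using this
  rintro (_ | l)
  · exact hnone
  · have := hcoord (j.succAbove l)
    simpa [hnone] using this

theorem card_sigma_fin (N : ℕ) : Fintype.card (Σ l : Fin N, Fin l) = N * (N - 1) / 2 := by
  rw [Fintype.card_sigma]
  simp only [Fintype.card_fin]
  rw [Fin.sum_univ_eq_sum_range (fun l => l), Finset.sum_range_id]

theorem theorem2 (m n : ℕ) (C : Matrix (Fin m) (Fin m) ℝ) (W : Fin n → ℝ) (Z : Fin m → ℝ)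
    (A : Matrix (Fin m) (Fin n) ℝ) (hC : A * Aᵀ = C) (hZ : A *ᵥ W = Z) (hW : W ≠ 0)
    (hrank : HasIndependentRows (augmented A W) (n - 1)) :
    HasDegreesOfFreedom (solutionSet C W Z) ((n - 1) * (n - 2) / 2) := by
  subst hC hZ
  obtain ⟨j, hj⟩ := Function.ne_iff.1 hW
  obtain ⟨N, rfl⟩ : ∃ N, n = N + 1 := ⟨n - 1, by have := j.2; omega⟩
  have hd : (N + 1 - 1) * (N + 1 - 2) / 2 = Fintype.card (Σ l : Fin N, Fin l) := by
    rw [card_sigma_fin]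
    rfl
  rw [hd]
  have hspan : N ≤ _ := hrank.le_finrank_span
  set e := rowsHomeomorph m (N + 1)
  set w : EuclideanSpace ℝ (Fin (N + 1)) := WithLp.toLp 2 W
  have hw : w ≠ 0 := fun h => hW ((WithLp.toLp_injective 2) h)
  have hN : Module.finrank ℝ (EuclideanSpace ℝ (Fin (N + 1))) = N + 1 := finrank_euclideanSpace_fin
  obtain ⟨r, hrinj, hr⟩ := exists_linearIndependent_option hw
    (a := e A) (M := N - 1) (by omega)
  have hu := linearIndependent_option_single_succAbove hj
  have hV := fun X => mem_solutionSet_iff A X W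
  have hch := isChartFamily_cayleyChart w (e A)
  have hcoord : ∀ (v : EuclideanSpace ℝ (Fin (N + 1))) (l : Fin N),
      ⟪v, EuclideanSpace.single (j.succAbove l) (1 : ℝ)⟫_ℝ = v (j.succAbove l) := by
    intro v l
    rw [EuclideanSpace.inner_single_right]
    simp
  -- The staircase `k < l`; as `l < N`, the `N - 1` chosen rows suffice.
  let pos : (Σ l : Fin N, Fin l) → Fin m × Fin (N + 1) := fun p =>
    (r ⟨p.2, by have := p.1.2; have := p.2.2; omega⟩, j.succAbove p.1)
  have hpos : Function.Injective pos := by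
    rintro ⟨l, k⟩ ⟨l', k'⟩ h
    have h1 : l = l' := Fin.succAbove_right_injective (Prod.ext_iff.1 h).2
    subst h1
    have h2 := congrArg Fin.val (hrinj (Prod.ext_iff.1 h).1)
    have h3 : k = k' := Fin.ext h2
    rw [h3]
  let ℓ (p : Fin m × Fin (N + 1)) : (Fin m → EuclideanSpace ℝ (Fin (N + 1))) →L[ℝ] ℝ :=
    (EuclideanSpace.proj p.2).comp (ContinuousLinearMap.proj p.1)
  let f : (Fin m → EuclideanSpace ℝ (Fin (N + 1))) →L[ℝ] ((Σ l : Fin N, Fin l) → ℝ) :=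
    ContinuousLinearMap.pi fun p => ℓ (pos p)
  have hreg : ∀ x ∈ congruentFamilies w (e A), ∀ O ∈ 𝓝 x, ∃ y ∈ congruentFamilies w (e A),
      y ∈ O ∧ Function.Injective (f.comp (orbitDifferential w y)) := by
    intro x hx O hO
    obtain ⟨y, hy, hyO, hyK⟩ := exists_regular hN hr hu hx hO
    refine ⟨y, hy, hyO, (injective_iff_map_eq_zero _).2 fun K hK => Subtype.ext ?_⟩
    refine hyK K.1 K.2 fun k l hkl => ?_
    rw [hcoord]
    exact congrFun hK ⟨l, ⟨k, hkl⟩⟩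
  have hA : e A ∈ congruentFamilies w (e A) := ⟨fun _ _ => rfl, fun _ => rfl⟩
  -- A regular point embeds the Lie algebra into the space of staircase entries, which bounds its
  -- dimension from above.
  have hfin : Module.finrank ℝ (stabilizerAlgebra w) = Fintype.card (Σ l : Fin N, Fin l) := by
    refine le_antisymm ?_ (card_le_finrank_stabilizerAlgebra hw hN)
    obtain ⟨y, -, -, hy⟩ := hreg _ hA univ univ_mem
    have := LinearMap.finrank_le_finrank_of_injective
      (f := (f.comp (orbitDifferential w y)).toLinearMap) hy
    rwa [Module.finrank_fintype_fun_eq_card] at this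
  refine ⟨⟨A, rfl, rfl⟩, ⟨Finset.univ.image pos, ?_, ?_⟩, fun S hS => ?_⟩
  · rw [Finset.card_image_of_injective _ hpos, Finset.card_univ]
  · refine ForGeneric.of_homeomorph e hV
      (P' := fun x => {y | y ∈ congruentFamilies w (e A) ∧ f y = f x}.Finite) (fun X hX => ?_)
      (hch.exists_isOpen_dense_finite_fibers (isCompact_congruentFamilies w _)
        (continuous_orbitDifferential w)
        (by rw [hfin, Module.finrank_fintype_fun_eq_card]) f hreg)
    refine (hX.preimage e.injective.injOn).subset fun Y hY => ⟨(hV Y).1 hY.1, ?_⟩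
    ext p
    exact hY.2 (pos p) (Finset.mem_image_of_mem _ (Finset.mem_univ p))
  · refine ForGeneric.of_homeomorph e hV
      (P' := fun x => {y | y ∈ congruentFamilies w (e A) ∧ ∀ p ∈ S, ℓ p y = ℓ p x}.Infinite)
      (fun X hX hcomp => hX ?_)
      (hch.exists_isOpen_dense_infinite_fibers (continuous_orbitDifferential w) ℓ ?_ S
        (by rwa [hfin]))
    · refine (hcomp.preimage e.symm.injective.injOn).subset fun y hy => ?_
      obtain ⟨Y, rfl⟩ := e.surjective y
      rw [mem_preimage, e.symm_apply_apply]
      exact ⟨(hV Y).2 hy.1, hy.2⟩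
    · intro x hx K hK
      refine Subtype.ext (eq_zero_of_forall_apply_eq_zero hx hN hspan K.2 fun i => ?_)
      ext j'
      exact hK (i, j')
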